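/- Let $q\in(0,1)$ be a fixed deletion probability. For $d\ge 2$ let $\{0,1\}^{n^{\times d}}$ be the set of $d$-dimensional binary hypermatrices $X$ of side length $n$, with entries $X_{k_1,\dots,k_d}$, $0\le k_i\le n-1$. A trace of $X$ is the random sub-hypermatrix (of random side lengths, remaining slices kept in order) obtained from $X$ by deleting, independently for all $i\in\{1,\dots,d\}$ and $k\in\{0,\dots,n-1\}$, the slice $\{k_i=k\}$ with probability $q$; for $d=2$ this means that each row and each column is deleted independently with probability $q$. We say that $T(n)$ traces suffice to reconstruct an arbitrary $X\in\{0,1\}^{n^{\times d}}$ with high probability if there are functions $R_n$ from $T(n)$-tuples of traces to $\{0,1\}^{n^{\times d}}$ such that $$\min_{X\in\{0,1\}^{n^{\times d}}}\Pr\bigl[R_n(\widetilde X^1,\dots,\widetilde X^{T(n)})=X\bigr]\to 1\quad (n\to\infty),$$ where $\widetilde X^1,\dots,\widetilde X^{T(n)}$ are independent traces of $X$. **Theorem.** Fix $q\in(0,1)$. Then: 1. There is a constant $C>0$, depending only on $q$, such that $\bigl\lceil\exp\bigl(C\,n^{3/7}(\log n)^{10/3}\bigr)\bigr\rceil$ traces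 suffice to reconstruct an arbitrary matrix $X\in\{0,1\}^{n\times n}$ with high probability. 2. There is a constant $C>0$, depending only on $q$, such that $\bigl\lceil\exp\bigl(C\,n^{5/9}(\log n)^{5/2}\bigr)\bigr\rceil$ traces suffice to reconstruct an arbitrary hypermatrix $X\in\{0,1\}^{n\times n\times n}$ with high probability. 3. For every fixed $d\ge 4$ there is a constant $C>0$, depending only on $q$ and $d$, such that $\bigl\lceil\exp\bigl(C\,n^{3/5}\log n\bigr)\bigr\rceil$ traces suffice to reconstruct an arbitrary hypermatrix $X\in\{0,1\}^{n^{\times d}}$ with high probability. -/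

import Mathlib

open MeasureTheory ProbabilityTheory Filter

/-- Binary `d`-dimensional hypermatrices with side lengths `m 0, …, m (d - 1)`. -/
abbrev BinArray {d : ℕ} (m : Fin d → ℕ) : Type := ((i : Fin d) → Fin (m i)) → Bool

/-- Binary `n^{×d}`-hypermatrices, that is `{0,1}^{n × ⋯ × n}` with `d` factors. -/
abbrev HyperMatrix (d n : ℕ) : Type := BinArray (fun _ : Fin d => n)

/-- What an observer sees of a trace: a hypermatrix of some shape (side lengths and entries,
without the original positions of the surviving slices). -/
abbrev Trace (d : ℕ) : Type := Σ m : Fin d → ℕ, BinArray m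

/-- A deletion pattern: `ω (i, k) = true` means that the `k`-th slice orthogonal to the `i`-th
coordinate direction (all entries whose `i`-th coordinate is `k`) is deleted. -/
abbrev DeletionPattern (d n : ℕ) : Type := Fin d × Fin n → Bool

/-- The indices of the slices in direction `i` that survive. -/
def survivors {d n : ℕ} (ω : DeletionPattern d n) (i : Fin d) : Finset (Fin n) :=
  Finset.univ.filter fun k => ω (i, k) = false

/-- The sub-hypermatrix of `X` that is left after the deletions prescribed by `ω`, with the
surviving slices in their original order. -/
def traceOf {d n : ℕ} (X : HyperMatrix d n) (ω : DeletionPattern d n) : Trace d :=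
  ⟨fun i => (survivors ω i).card,
    fun j => X fun i => (survivors ω i).orderEmbOfFin rfl (j i)⟩

/-- The deletion channel: every slice in every direction is deleted independently with
probability `q`. -/
noncomputable def deletionLaw (q : unitInterval) (d n : ℕ) : Measure (DeletionPattern d n) :=
  Measure.pi fun _ => bernoulliMeasure true false q

/-- The law of the deletion patterns of `T` independent traces. -/
noncomputable def tracesLaw (q : unitInterval) (d n T : ℕ) :
    Measure (Fin T → DeletionPattern d n) :=
  Measure.pi fun _ => deletionLaw q d n

/-- A reconstruction procedure: a guess for the unknown hypermatrix of side length `n` from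
`T` observed traces. -/
abbrev Reconstructor (d n T : ℕ) : Type := (Fin T → Trace d) → HyperMatrix d n

/-- The probability that `R` recovers `X` from `T` independent traces of `X`. -/
noncomputable def successProb (q : unitInterval) {d n T : ℕ} (R : Reconstructor d n T)
    (X : HyperMatrix d n) : ℝ :=
  (tracesLaw q d n T).real {ω | R (fun t => traceOf X (ω t)) = X}

/-- `T n` traces suffice to reconstruct an arbitrary binary `n^{×d}`-hypermatrix with high
probability: some reconstruction procedures, depending only on `n`, have a success probability
that tends to `1` as `n` grows, uniformly over all hypermatrices. -/
def TracesSuffice (q : unitInterval) (d : ℕ) (T : ℕ → ℕ) : Prop :=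
  ∃ R : (n : ℕ) → Reconstructor d n (T n),
    ∀ ε : ℝ, 0 < ε → ∀ᶠ n : ℕ in atTop, ∀ X : HyperMatrix d n, 1 - ε ≤ successProb q (R n) X

/-! All three bounds follow from a stronger one: in every dimension $\exp(O(n^{3/7}))$ traces
suffice (`tracesSuffice_exp`). By Hoeffding and a union bound it is enough to separate any $X\ne Y$
by the mean of a bounded statistic of one trace, with gap $\exp(-O(n^{3/7}))$
(`tracesSuffice_of_separating`, `exists_separation`).

Instead of single entries, one compares occurrences of a window pattern of radius $4r$, $r\approx
n^{2/5}$. The pattern is read off just before the lexicographically first difference $k_0$, its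
centre being chosen so that it has no short period. Its occurrences in either array are then sparse,
and within distance $r$ of $k_0$ the two occurrence indicators differ at $k_0$ and at most one more
point (`exists_separating_pattern`). Averaging against a power of a Dirichlet kernel of length
$R\approx n^{5/7}$ isolates $k_0$, because $Rr$ exceeds $n$ by a power of $n$. Hence the exponential
sum over the differences has modulus at least $1/(2n^3)$ at some angles $O(R/n)$
(`exists_large_exponential_sum`).

Such a sum is estimated from a trace by counting choices of slices with complex weights. A slice
before the window gets the weight $w$ with $q+(1-q)w=e^{i\theta}$; since $|w|\le e^{O(\theta^2)}$,
the total cost is $e^{O(n\theta^2)}=e^{O(n^{3/7})}$. A slice in a gap gets $v$ with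
$q+(1-q)v=\zeta$. At $\zeta=0$ only contiguous windows survive in the mean, but there $v=-q/(1-q)$
may have modulus above $1$. The mean is holomorphic in $\zeta$, so a maximum principle for a product
of finitely many rotated copies moves its size from $0$ to a point of $|\zeta|=q$ close to $q$,
where $|v|\le1$ (`exists_large_near_positive_real`). This costs a bounded power of quantities
$\exp(O(r\log n))$, which is affordable as $2/5<3/7$. -/

instance (q : unitInterval) (d n : ℕ) : IsProbabilityMeasure (deletionLaw q d n) := by
  unfold deletionLaw; infer_instance

instance (q : unitInterval) (d n T : ℕ) : IsProbabilityMeasure (tracesLaw q d n T) := by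
  unfold tracesLaw; infer_instance

/-! ### Reduction to separating statistics. -/

/-- The expectation of a statistic of a single trace of `X`. -/
noncomputable def meanStat (q : unitInterval) {d n : ℕ} (G : Trace d → ℝ) (X : HyperMatrix d n) :
    ℝ :=
  ∫ ω, G (traceOf X ω) ∂deletionLaw q d n

/-- Hoeffding's inequality for the sum of independent copies of a bounded function. -/
lemma measureReal_sum_ge_le {Ω : Type*} [MeasurableSpace Ω] [DiscreteMeasurableSpace Ω]
    (μ : Measure Ω) [IsProbabilityMeasure μ] (T : ℕ) (f : Ω → ℝ) (hf : ∀ ω, |f ω| ≤ 1)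
    {ε : ℝ} (hε : 0 ≤ ε) :
    (Measure.pi fun _ : Fin T => μ).real {ω | T * ε ≤ ∑ t, (f (ω t) - ∫ x, f x ∂μ)} ≤
      Real.exp (-(T * ε ^ 2 / 2)) := by
  have hind : iIndepFun (fun (t : Fin T) (ω : Fin T → Ω) => f (ω t) - ∫ x, f x ∂μ)
      (Measure.pi fun _ : Fin T => μ) :=
    iIndepFun_pi (μ := fun _ : Fin T => μ) (X := fun _ x => f x - ∫ x, f x ∂μ)
      fun _ => Measurable.of_discrete.aemeasurable
  have hsub : ∀ t ∈ (Finset.univ : Finset (Fin T)),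
      HasSubgaussianMGF (fun ω : Fin T → Ω => f (ω t) - ∫ x, f x ∂μ) 1
        (Measure.pi fun _ : Fin T => μ) := by
    intro t _
    have h := hasSubgaussianMGF_of_mem_Icc (μ := Measure.pi fun _ : Fin T => μ)
      (X := fun ω => f (ω t)) (a := -1) (b := 1)
      (Measurable.of_discrete.comp (measurable_pi_apply t)).aemeasurable
      (ae_of_all _ fun ω => by simpa [abs_le] using hf (ω t))
    rw [integral_comp_eval (μ := fun _ : Fin T => μ) (f := f)
      Measurable.of_discrete.aestronglyMeasurable] at h
    convert h using 1
    ext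
    simp
    norm_num
  refine (HasSubgaussianMGF.measure_sum_ge_le_of_iIndepFun hind hsub (by positivity)).trans ?_
  rw [Real.exp_le_exp]
  rcases Nat.eq_zero_or_pos T with rfl | hT
  · simp
  · have : (0 : ℝ) < T := by exact_mod_cast hT
    simp only [Finset.sum_const, Finset.card_univ, Fintype.card_fin, nsmul_eq_mul, mul_one,
      NNReal.coe_natCast]
    apply le_of_eq
    field_simp

lemma measureReal_abs_sum_ge_le {Ω : Type*} [MeasurableSpace Ω] [DiscreteMeasurableSpace Ω]
    (μ : Measure Ω) [IsProbabilityMeasure μ] (T : ℕ) (f : Ω → ℝ) (hf : ∀ ω, |f ω| ≤ 1)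
    {ε : ℝ} (hε : 0 ≤ ε) :
    (Measure.pi fun _ : Fin T => μ).real {ω | T * ε ≤ |∑ t, (f (ω t) - ∫ x, f x ∂μ)|} ≤
      2 * Real.exp (-(T * ε ^ 2 / 2)) := by
  have h1 := measureReal_sum_ge_le μ T f hf hε
  have h2 := measureReal_sum_ge_le μ T (fun x => -f x) (by simpa using hf) hε
  rw [two_mul]
  refine le_trans (measureReal_mono ?_ (measure_ne_top _ _)) ((measureReal_union_le _ _).trans
    (add_le_add h1 h2))
  intro ω hω
  simp only [Set.mem_ofPred_eq, Set.mem_union] at hω ⊢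
  rcases le_abs.1 hω with h | h
  · exact Or.inl h
  · right
    refine h.trans (le_of_eq ?_)
    rw [integral_neg, ← Finset.sum_neg_distrib]
    exact Finset.sum_congr rfl fun _ _ => by ring

/-- If every two distinct hypermatrices are told apart by the mean of one of finitely many bounded
statistics, some reconstruction procedure succeeds with the probability given by Hoeffding's
inequality and the union bound. -/
lemma exists_reconstructor (q : unitInterval) {d n : ℕ} (T : ℕ) {I : Type*} [Fintype I]
    (G : I → Trace d → ℝ) (hG : ∀ i (Z : HyperMatrix d n) ω, |G i (traceOf Z ω)| ≤ 1)
    {ε : ℝ} (hε : 0 < ε)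
    (hsep : ∀ X Y : HyperMatrix d n, X ≠ Y → ∃ i, ε ≤ |meanStat q (G i) X - meanStat q (G i) Y|) :
    ∃ R : Reconstructor d n T, ∀ X, 1 - Fintype.card I * (2 * Real.exp (-(T * (ε / 2) ^ 2 / 2))) ≤
      successProb q R X := by
  classical
  -- A candidate is accepted if every empirical sum is within half the separation of its expected
  -- value; two candidates cannot both be accepted.
  let ok : (Fin T → Trace d) → HyperMatrix d n → Prop := fun τ X =>
    ∀ i, |∑ t, (G i (τ t) - meanStat q (G i) X)| < T * (ε / 2)
  have huniq : ∀ τ X Y, ok τ X → ok τ Y → X = Y := by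
    intro τ X Y hX hY
    by_contra hne
    obtain ⟨i, hi⟩ := hsep X Y hne
    have hx := hX i
    have hy := hY i
    have hT : (0 : ℝ) ≤ T := Nat.cast_nonneg T
    have key : (T : ℝ) * |meanStat q (G i) X - meanStat q (G i) Y| < T * ε := by
      rw [← abs_of_nonneg hT, ← abs_mul, abs_of_nonneg hT]
      have : (T : ℝ) * (meanStat q (G i) X - meanStat q (G i) Y) =
          ∑ t, (G i (τ t) - meanStat q (G i) Y) - ∑ t, (G i (τ t) - meanStat q (G i) X) := by
        rw [← Finset.sum_sub_distrib]
        simp [mul_sub]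
      rw [this]
      calc _ ≤ _ := abs_sub _ _
        _ < T * (ε / 2) + T * (ε / 2) := add_lt_add hy hx
        _ = T * ε := by ring
    exact absurd (mul_le_mul_of_nonneg_left hi hT) (not_le.2 key)
  refine ⟨fun τ => if h : ∃ X, ok τ X then h.choose else fun _ => false, fun X => ?_⟩
  let bad : I → Set (Fin T → DeletionPattern d n) := fun i =>
    {ω | T * (ε / 2) ≤ |∑ t, (G i (traceOf X (ω t)) - meanStat q (G i) X)|}
  have hbad : ∀ i, (tracesLaw q d n T).real (bad i) ≤
      2 * Real.exp (-(T * (ε / 2) ^ 2 / 2)) := fun i =>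
    measureReal_abs_sum_ge_le (deletionLaw q d n) T (fun ω => G i (traceOf X ω)) (hG i X)
      (by positivity)
  have hU : (tracesLaw q d n T).real (⋃ i, bad i) ≤
      Fintype.card I * (2 * Real.exp (-(T * (ε / 2) ^ 2 / 2))) := by
    refine (measureReal_iUnion_fintype_le _).trans ?_
    refine (Finset.sum_le_sum fun i _ => hbad i).trans ?_
    simp
  have hcompl := probReal_compl_eq_one_sub (μ := tracesLaw q d n T)
    (MeasurableSet.of_discrete (s := ⋃ i, bad i))
  refine le_trans (by rw [hcompl]; linarith) (measureReal_mono (fun ω hω => ?_)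
    (measure_ne_top _ _))
  have hok : ok (fun t => traceOf X (ω t)) X := by
    intro i
    by_contra hcon
    exact hω (Set.mem_iUnion.2 ⟨i, not_lt.1 hcon⟩)
  change (if h : ∃ Z, ok (fun t => traceOf X (ω t)) Z then h.choose else fun _ => false) = X
  have hex' : ∃ Z, ok (fun t => traceOf X (ω t)) Z := ⟨X, hok⟩
  rw [dif_pos hex']
  exact huniq _ _ _ hex'.choose_spec hok

/-- If any two hypermatrices are separated by the mean of a bounded statistic, with separation
`ε n`, then of order `n ^ d / ε n ^ 2` traces suffice. -/
theorem tracesSuffice_of_separating (q : unitInterval) (d : ℕ) (T : ℕ → ℕ) (ε : ℕ → ℝ)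
    (hε : ∀ n, 0 < ε n)
    (hsep : ∀ᶠ n in atTop, ∀ X Y : HyperMatrix d n, X ≠ Y → ∃ G : Trace d → ℝ,
      (∀ (Z : HyperMatrix d n) ω, |G (traceOf Z ω)| ≤ 1) ∧
        ε n ≤ |meanStat q G X - meanStat q G Y|)
    (hT : ∀ᶠ n : ℕ in atTop, 8 * (2 * (n : ℝ) ^ d + n) ≤ ε n ^ 2 * T n) :
    TracesSuffice q d T := by
  classical
  have key : ∀ᶠ n : ℕ in atTop, ∃ R : Reconstructor d n (T n),
      ∀ X, 1 - 2 * Real.exp (-n) ≤ successProb q R X := by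
    filter_upwards [hsep, hT] with n hn hTn
    choose! G hG using hn
    -- The statistics are indexed by all pairs; on the diagonal `G` carries no bound and is replaced
    -- by zero.
    let H : HyperMatrix d n × HyperMatrix d n → Trace d → ℝ := fun p =>
      if p.1 = p.2 then 0 else G p.1 p.2
    obtain ⟨R, hR⟩ := exists_reconstructor (n := n) q (T n) H
      (by
        intro p Z ω
        by_cases h : p.1 = p.2
        · simp [H, h]
        · simpa [H, h] using (hG p.1 p.2 h).1 Z ω)
      (hε n)
      (by
        intro X Y hXY
        exact ⟨(X, Y), by simpa [H, hXY] using (hG X Y hXY).2⟩)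
    refine ⟨R, fun X => le_trans ?_ (hR X)⟩
    have hcard : (Fintype.card (HyperMatrix d n × HyperMatrix d n) : ℝ) = 4 ^ (n ^ d) := by
      simp only [Fintype.card_prod, Fintype.card_fun, Fintype.card_bool, Fintype.card_fin]
      push_cast
      rw [← mul_pow]
      norm_num
    have h4 : (4 : ℝ) ^ (n ^ d) ≤ Real.exp (2 * (n : ℝ) ^ d) := by
      have h2 : (2 : ℝ) ≤ Real.exp 1 := by
        have := Real.add_one_le_exp (1 : ℝ); linarith
      have : (4 : ℝ) ≤ Real.exp 2 := by
        have h := mul_le_mul h2 h2 (by norm_num) (by positivity)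
        rw [← Real.exp_add] at h
        norm_num at h
        exact h
      calc (4 : ℝ) ^ (n ^ d) ≤ Real.exp 2 ^ (n ^ d) := by gcongr
        _ = Real.exp (2 * (n : ℝ) ^ d) := by
          rw [← Real.exp_nat_mul]; push_cast; ring_nf
    -- The exponent is $T\varepsilon^2/8\ge 2n^d+n$: the first term pays for the $4^{n^d}$ pairs,
    -- the second tends to infinity.
    have hexp : Real.exp (-(T n * (ε n / 2) ^ 2 / 2)) ≤
        Real.exp (-(2 * (n : ℝ) ^ d)) * Real.exp (-n) := by
      rw [← Real.exp_add, Real.exp_le_exp]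
      nlinarith
    have : (Fintype.card (HyperMatrix d n × HyperMatrix d n) : ℝ) *
        (2 * Real.exp (-(T n * (ε n / 2) ^ 2 / 2))) ≤ 2 * Real.exp (-n) := by
      rw [hcard]
      calc (4 : ℝ) ^ (n ^ d) * (2 * Real.exp (-(T n * (ε n / 2) ^ 2 / 2)))
          ≤ Real.exp (2 * (n : ℝ) ^ d) *
            (2 * (Real.exp (-(2 * (n : ℝ) ^ d)) * Real.exp (-n))) := by gcongr
        _ = (Real.exp (2 * (n : ℝ) ^ d) * Real.exp (-(2 * (n : ℝ) ^ d))) *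
            (2 * Real.exp (-n)) := by ring
        _ = 2 * Real.exp (-n) := by rw [← Real.exp_add]; simp
    linarith
  let R : (n : ℕ) → Reconstructor d n (T n) := fun n =>
    if h : ∃ R : Reconstructor d n (T n), ∀ X, 1 - 2 * Real.exp (-n) ≤ successProb q R X then
      h.choose else fun _ _ => false
  refine ⟨R, fun δ hδ => ?_⟩
  have hlim : Tendsto (fun n : ℕ => 2 * Real.exp (-(n : ℝ))) atTop (nhds (2 * 0)) :=
    (Real.tendsto_exp_neg_atTop_nhds_zero.comp tendsto_natCast_atTop_atTop).const_mul 2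
  rw [mul_zero] at hlim
  filter_upwards [key, hlim.eventually (gt_mem_nhds hδ)] with n hn hd X
  have : R n = hn.choose := dif_pos hn
  rw [this]
  have := hn.choose_spec X
  linarith

/-! ### Window patterns and their periods. -/

/-- `j` lies in the cube of radius `r` around the origin. -/
def InCube {d : ℕ} (r : ℕ) (j : Fin d → ℤ) : Prop := ∀ i, |j i| ≤ r

lemma InCube.neg {d r : ℕ} {j : Fin d → ℤ} (h : InCube r j) : InCube r (-j) := fun i => by
  simpa using h i

lemma InCube.add {d r s : ℕ} {j k : Fin d → ℤ} (h : InCube r j) (h' : InCube s k) :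
    InCube (r + s) (j + k) := fun i => by
  have := (abs_add_le (j i) (k i)).trans (add_le_add (h i) (h' i))
  simpa using this

lemma InCube.mono {d r s : ℕ} (hrs : r ≤ s) {j : Fin d → ℤ} (h : InCube r j) : InCube s j :=
  fun i => (h i).trans (by exact_mod_cast hrs)

/-- The lexicographically negative half of the window of radius `R` around `k` in `x` shows the
pattern `u`, and the centre of the window is `c`. -/
def Occurs {d : ℕ} (R : ℕ) (u : (Fin d → ℤ) → Bool) (c : Bool) (x : (Fin d → ℤ) → Bool)
    (k : Fin d → ℤ) : Prop :=
  (∀ j, InCube R j → toLex j < 0 → x (k + j) = u j) ∧ x k = c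

/-- `v` is a period of the half-window pattern `u` with centre `c`. -/
def IsPeriod {d : ℕ} (R : ℕ) (u : (Fin d → ℤ) → Bool) (c : Bool) (v : Fin d → ℤ) : Prop :=
  u (-v) = c ∧ ∀ j, InCube R j → toLex j < 0 → InCube R (j - v) → u j = u (j - v)

/-- A half-window pattern has no short period for one of the two possible values of its centre. -/
lemma exists_centre_no_period {d : ℕ} (r : ℕ) (u : (Fin d → ℤ) → Bool) :
    ∃ c, ∀ v, 0 < toLex v → InCube (2 * r) v → ¬ IsPeriod (4 * r) u c v := by
  by_contra! h
  obtain ⟨v, hv0, hv, hvc, hvp⟩ := h false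
  obtain ⟨w, hw0, hw, hwc, hwp⟩ := h true
  have h2 : 2 * r ≤ 4 * r := by lia
  have hsum : InCube (4 * r) (-v - w) := by
    have := hv.neg.add hw.neg
    rw [← sub_eq_add_neg] at this
    exact this.mono (by lia)
  -- Starting from $-v$ and $-w$, the periods $w$ and $v$ lead to the same point $-v-w$, which is
  -- still in the window; so $u(-v)=u(-w)$, although these values are the two different centres.
  have e1 := hwp (-v) (hv.neg.mono h2) (by rw [toLex_neg]; exact neg_lt_zero.2 hv0) hsum
  have e2 := hvp (-w) (hw.neg.mono h2) (by rw [toLex_neg]; exact neg_lt_zero.2 hw0)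
    (by rwa [neg_sub_comm])
  rw [neg_sub_comm, ← e1, hvc, hwc] at e2
  exact absurd e2 (by simp)

/-- Two overlapping occurrences make the pattern agree with its own shift, and the centre of the
earlier one is read by the later one at $-v$. -/
lemma Occurs.isPeriod {d R : ℕ} {u : (Fin d → ℤ) → Bool} {c : Bool} {x : (Fin d → ℤ) → Bool}
    {k v : Fin d → ℤ} (hk : Occurs R u c x k) (hkv : Occurs R u c x (k + v)) (hv : 0 < toLex v)
    (hvR : InCube R v) : IsPeriod R u c v := by
  constructor
  · have := hkv.1 (-v) hvR.neg (by rw [toLex_neg]; exact neg_lt_zero.2 hv)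
    rw [add_neg_cancel_right, hk.2] at this
    exact this.symm
  · intro j hj hj0 hjv
    have h1 := hk.1 j hj hj0
    have h2 := hkv.1 (j - v) hjv (by
      rw [toLex_sub]; exact (sub_lt_self _ hv).trans hj0)
    rw [← h1, ← h2]
    congr 1
    abel

lemma Occurs.eq_of_near {d r : ℕ} {u : (Fin d → ℤ) → Bool} {c : Bool}
    (hc : ∀ v, 0 < toLex v → InCube (2 * r) v → ¬ IsPeriod (4 * r) u c v)
    {x : (Fin d → ℤ) → Bool} {k l : Fin d → ℤ} (hk : Occurs (4 * r) u c x k)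
    (hl : Occurs (4 * r) u c x l) (hkl : InCube (2 * r) (l - k)) : k = l := by
  have h24 : 2 * r ≤ 4 * r := by lia
  rcases lt_trichotomy (toLex (l - k)) 0 with h | h | h
  · have hkl' : InCube (2 * r) (k - l) := by simpa using hkl.neg
    have hpos : 0 < toLex (k - l) := by
      rw [← neg_sub, toLex_neg]; exact neg_pos.2 h
    exact absurd (hl.isPeriod (v := k - l) (by simpa using hk) hpos (hkl'.mono h24))
      (hc _ hpos hkl')
  · have : l - k = 0 := h
    exact (sub_eq_zero.1 this).symm
  · exact absurd (hk.isPeriod (v := l - k) (by simpa using hl) h (hkl.mono h24)) (hc _ h hkl)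

/-- Two different arrays with finitely many differences are told apart by the occurrences of some
window pattern: near one of the places where only one of the arrays has an occurrence there is at
most one other such place. -/
lemma exists_separating_pattern {d : ℕ} (r : ℕ) (x y : (Fin d → ℤ) → Bool)
    (hfin : {k | x k ≠ y k}.Finite) (hne : x ≠ y) :
    ∃ φ : ((Fin d → ℤ) → Bool) → ℤ,
      (∀ v w, (∀ j, InCube (4 * r) j → v j = w j) → φ v = φ w) ∧
      (∀ v, 0 ≤ φ v ∧ φ v ≤ 1) ∧
      ∃ k₀, x k₀ ≠ y k₀ ∧
        |φ (fun j => x (k₀ + j)) - φ (fun j => y (k₀ + j))| = 1 ∧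
        ∃ b, ∀ k, k ≠ k₀ → k ≠ b → InCube r (k - k₀) →
          φ (fun j => x (k + j)) = φ (fun j => y (k + j)) := by
  classical
  have hnon : {k | x k ≠ y k}.Nonempty := by
    by_contra h
    rw [Set.not_nonempty_iff_eq_empty] at h
    exact hne (funext fun k => not_not.1 fun hk => (h ▸ hk : k ∈ (∅ : Set (Fin d → ℤ))))
  obtain ⟨k₀, hk₀, hmin⟩ := Set.exists_min_image _ (fun k => toLex k) hfin hnon
  have hbefore : ∀ j : Fin d → ℤ, toLex j < 0 → x (k₀ + j) = y (k₀ + j) := by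
    intro j hj
    by_contra hcon
    have h := hmin _ hcon
    rw [toLex_add] at h
    exact absurd (le_add_iff_nonneg_right _ |>.1 h) (not_le.2 hj)
  set u : (Fin d → ℤ) → Bool := fun j => x (k₀ + j) with hu
  obtain ⟨c, hc⟩ := exists_centre_no_period r u
  have hshift : ∀ (z : (Fin d → ℤ) → Bool) k,
      Occurs (4 * r) u c (fun j => z (k + j)) 0 ↔ Occurs (4 * r) u c z k := by
    intro z k
    simp [Occurs]
  let φ : ((Fin d → ℤ) → Bool) → ℤ := fun w => if Occurs (4 * r) u c w 0 then 1 else 0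
  have hφ : ∀ (z : (Fin d → ℤ) → Bool) k,
      φ (fun j => z (k + j)) = if Occurs (4 * r) u c z k then 1 else 0 := by
    intro z k
    simp only [φ, hshift]
  -- Before `k₀` both arrays show `u`; at `k₀` their entries are the two Booleans, so exactly one of
  -- them equals `c`.
  have hxy : Occurs (4 * r) u c x k₀ ∧ ¬ Occurs (4 * r) u c y k₀ ∨
      ¬ Occurs (4 * r) u c x k₀ ∧ Occurs (4 * r) u c y k₀ := by
    have hk₀' : x k₀ ≠ y k₀ := hk₀
    by_cases hxc : x k₀ = c
    · left
      exact ⟨⟨fun j _ _ => rfl, hxc⟩, fun h => hk₀' (hxc.trans h.2.symm)⟩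
    · right
      refine ⟨fun h => hxc h.2, fun j _ hj => (hbefore j hj).symm, ?_⟩
      revert hk₀' hxc
      cases x k₀ <;> cases y k₀ <;> cases c <;> simp
  refine ⟨φ, ?_, ?_, k₀, hk₀, ?_, ?_⟩
  · intro v w hvw
    have : Occurs (4 * r) u c v 0 ↔ Occurs (4 * r) u c w 0 := by
      unfold Occurs
      refine and_congr (forall_congr' fun j => ?_) (by rw [hvw 0 fun i => by simp])
      refine imp_congr_right fun hj => ?_
      rw [zero_add, hvw j hj]
    simp only [φ, this]
  · intro v
    simp only [φ]
    split_ifs <;> simp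
  · rw [hφ, hφ]
    rcases hxy with ⟨h1, h2⟩ | ⟨h1, h2⟩ <;> simp [h1, h2]
  · have near : ∀ k l : Fin d → ℤ, InCube r (k - k₀) → InCube r (l - k₀) →
        InCube (2 * r) (l - k) := by
      intro k l hk hl
      have := hl.add hk.neg
      rw [← two_mul] at this
      convert this using 1
      abel
    have near₀ : ∀ k : Fin d → ℤ, InCube r (k - k₀) → InCube (2 * r) (k - k₀) := fun k hk =>
      hk.mono (by lia)
    by_cases hb : ∃ b, b ≠ k₀ ∧ InCube r (b - k₀) ∧
        ¬ (Occurs (4 * r) u c x b ↔ Occurs (4 * r) u c y b)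
    · obtain ⟨b, hb0, hbr, hbd⟩ := hb
      refine ⟨b, fun k hk0 hkb hkr => ?_⟩
      rw [hφ, hφ]
      rcases hxy with ⟨h1, -⟩ | ⟨-, h1⟩
      · have hxk : ¬ Occurs (4 * r) u c x k := fun h => hk0 (h1.eq_of_near hc h (near₀ k hkr)).symm
        have hxb : ¬ Occurs (4 * r) u c x b := fun h => hb0 (h1.eq_of_near hc h (near₀ b hbr)).symm
        have hyb : Occurs (4 * r) u c y b := by tauto
        have hyk : ¬ Occurs (4 * r) u c y k := fun h => hkb (h.eq_of_near hc hyb (near k b hkr hbr))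
        simp [hxk, hyk]
      · have hxk : ¬ Occurs (4 * r) u c y k := fun h => hk0 (h1.eq_of_near hc h (near₀ k hkr)).symm
        have hxb : ¬ Occurs (4 * r) u c y b := fun h => hb0 (h1.eq_of_near hc h (near₀ b hbr)).symm
        have hyb : Occurs (4 * r) u c x b := by tauto
        have hyk : ¬ Occurs (4 * r) u c x k := fun h => hkb (h.eq_of_near hc hyb (near k b hkr hbr))
        simp [hxk, hyk]
    · push Not at hb
      -- There is no second place; `k₀` is a dummy value for it.
      refine ⟨k₀, fun k hk0 _ hkr => ?_⟩
      rw [hφ, hφ, if_congr (hb k hk0 hkr) rfl rfl]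

/-! ### Dirichlet kernels and exponential sums near the origin. -/

/-- The unit complex number of argument `π t x / n`. -/
noncomputable def phase (n : ℕ) (t x : ℝ) : ℂ := Complex.exp (((Real.pi * t * x / n : ℝ) : ℂ) * Complex.I)

lemma norm_phase (n : ℕ) (t x : ℝ) : ‖phase n t x‖ = 1 := Complex.norm_exp_ofReal_mul_I _

lemma phase_add_left (n : ℕ) (s t x : ℝ) : phase n (s + t) x = phase n s x * phase n t x := by
  rw [phase, phase, phase, ← Complex.exp_add]
  push_cast
  ring_nf

lemma phase_zero_left (n : ℕ) (x : ℝ) : phase n 0 x = 1 := by simp [phase]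

lemma phase_add_right (n : ℕ) (t x y : ℝ) : phase n t (x + y) = phase n t x * phase n t y := by
  rw [phase, phase, phase, ← Complex.exp_add]
  push_cast
  ring_nf

lemma phase_sum_left {ι : Type*} (n : ℕ) (s : Finset ι) (t : ι → ℝ) (x : ℝ) :
    phase n (∑ i ∈ s, t i) x = ∏ i ∈ s, phase n (t i) x := by
  classical
  induction s using Finset.induction_on with
  | empty => simp [phase_zero_left]
  | insert a s ha ih => rw [Finset.sum_insert ha, Finset.prod_insert ha, phase_add_left, ih]

lemma phase_natCast_left (n t : ℕ) (x : ℝ) : phase n t x = phase n 1 x ^ t := by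
  rw [phase, phase, ← Complex.exp_nat_mul]
  push_cast
  ring_nf

lemma phase_natCast_right (n k : ℕ) (t : ℝ) : phase n t k = phase n t 1 ^ k := by
  rw [phase, phase, ← Complex.exp_nat_mul]
  push_cast
  ring_nf

/-- The normalised Dirichlet kernel. -/
noncomputable def dirichletMean (n R : ℕ) (x : ℝ) : ℂ := (∑ j : Fin R, phase n (j : ℕ) x) / R

lemma norm_dirichletMean_le_one (n R : ℕ) (x : ℝ) : ‖dirichletMean n R x‖ ≤ 1 := by
  rw [dirichletMean, norm_div, Complex.norm_natCast]
  refine div_le_one_of_le₀ ((norm_sum_le _ _).trans ?_) (Nat.cast_nonneg _)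
  simp [norm_phase]

/-- The argument $\pi x/n$ lies in $[-\pi,\pi]$, where a chord is at least $2/\pi$ times its arc. -/
lemma le_norm_phase_sub_one {n : ℕ} {x : ℝ} (hx : |x| ≤ n) : 2 * |x| / n ≤ ‖phase n 1 x - 1‖ := by
  rcases Nat.eq_zero_or_pos n with rfl | hn
  · simp
  have hn' : (0 : ℝ) < n := by exact_mod_cast hn
  have hpi := Real.pi_pos
  rw [phase, mul_comm _ Complex.I, Complex.norm_exp_I_mul_ofReal_sub_one, norm_mul, Real.norm_ofNat,
    Real.norm_eq_abs]
  have habs : |Real.pi * 1 * x / n / 2| = Real.pi * |x| / n / 2 := by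
    rw [abs_div, abs_div, abs_mul, mul_one, abs_of_pos hpi, abs_of_pos hn', abs_two]
  have hle : |Real.pi * 1 * x / n / 2| ≤ Real.pi / 2 := by
    rw [habs]
    gcongr
    rw [div_le_iff₀ hn']
    gcongr
  have h := Real.mul_abs_le_abs_sin hle
  rw [habs] at h
  calc 2 * |x| / n = 2 * (2 / Real.pi * (Real.pi * |x| / n / 2)) := by field_simp
    _ ≤ _ := by gcongr

lemma norm_dirichletMean_le_div {n R : ℕ} (hR : 0 < R) {x : ℝ} (hx0 : 0 < |x|) (hx : |x| ≤ n) :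
    ‖dirichletMean n R x‖ ≤ n / (R * |x|) := by
  have hn' : (0 : ℝ) < n := hx0.trans_le hx
  have hR' : (0 : ℝ) < R := by exact_mod_cast hR
  have hgeom : (∑ j : Fin R, phase n (j : ℕ) x) * (phase n 1 x - 1) = phase n 1 x ^ R - 1 := by
    rw [← geom_sum_mul, Finset.sum_range]
    simp only [phase_natCast_left]
  have h2 : ‖phase n 1 x ^ R - 1‖ ≤ 2 := by
    refine (norm_sub_le _ _).trans ?_
    rw [norm_pow, norm_phase, one_pow, norm_one]
    norm_num
  rw [← hgeom, norm_mul] at h2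
  have h3 := (mul_le_mul_of_nonneg_left (le_norm_phase_sub_one hx) (norm_nonneg _)).trans h2
  rw [dirichletMean, norm_div, Complex.norm_natCast, div_le_div_iff₀ hR' (by positivity)]
  have h4 : ‖∑ j : Fin R, phase n (j : ℕ) x‖ * |x| ≤ n := by
    rw [mul_div_assoc', div_le_iff₀ hn'] at h3
    linarith
  nlinarith

/-- The first two terms of the sum already lose $1/n^2$ by the parallelogram law; division by $R\le
n$ leaves $1/n^3$. This handles the one neighbour that may lie very close to the isolated point. -/
lemma norm_dirichletMean_le_one_sub {n R : ℕ} (hR : 2 ≤ R) (hRn : R ≤ n) {x : ℝ} (hx1 : 1 ≤ |x|)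
    (hx : |x| ≤ n) : ‖dirichletMean n R x‖ ≤ 1 - 1 / n ^ 3 := by
  obtain ⟨S, rfl⟩ := Nat.exists_eq_add_of_le' hR
  have hn' : (1 : ℝ) ≤ n := hx1.trans hx
  have hn0 : (0 : ℝ) < n := by linarith
  have hlow : 2 / (n : ℝ) ≤ ‖phase n 1 x - 1‖ := by
    refine le_trans ?_ (le_norm_phase_sub_one hx)
    gcongr
    linarith
  have hpar := parallelogram_law_with_norm ℝ (phase n 1 x) 1
  rw [norm_phase, norm_one] at hpar
  have hinv : 1 / (n : ℝ) ^ 2 ≤ 1 := by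
    rw [div_le_one (by positivity)]; nlinarith
  have hplus : ‖phase n 1 x + 1‖ ≤ 2 - 1 / n ^ 2 := by
    refine abs_le_of_sq_le_sq' ?_ (by linarith) |>.2
    have : (2 / (n : ℝ)) ^ 2 ≤ ‖phase n 1 x - 1‖ ^ 2 := by gcongr
    have e : (2 / (n : ℝ)) ^ 2 = 4 * (1 / n ^ 2) := by field_simp; norm_num
    nlinarith [sq_nonneg (1 / (n : ℝ) ^ 2)]
  have hsum : ‖∑ j : Fin (S + 2), phase n (j : ℕ) x‖ ≤ (S + 2 : ℕ) - 1 / n ^ 2 := by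
    rw [Fin.sum_univ_eq_sum_range (fun j : ℕ => phase n j x), Finset.sum_range_succ',
      Finset.sum_range_succ', add_assoc]
    refine (norm_add_le _ _).trans ?_
    have h1 : ‖phase n ((0 + 1 : ℕ) : ℝ) x + phase n ((0 : ℕ) : ℝ) x‖ ≤ 2 - 1 / n ^ 2 := by
      simpa [phase_zero_left] using hplus
    have h2 : ‖∑ i ∈ Finset.range S, phase n ((i + 1 + 1 : ℕ) : ℝ) x‖ ≤ S := by
      refine (norm_sum_le _ _).trans ?_
      simp [norm_phase]
    push_cast at h1 h2 ⊢
    linarith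
  have hR0 : (0 : ℝ) < (S + 2 : ℕ) := by positivity
  rw [dirichletMean, norm_div, Complex.norm_natCast, div_le_iff₀ hR0]
  refine hsum.trans ?_
  have hRn' : ((S + 2 : ℕ) : ℝ) ≤ n := by exact_mod_cast hRn
  have e : 1 / (n : ℝ) ^ 3 * (n : ℝ) = 1 / (n : ℝ) ^ 2 := by field_simp
  have : 1 / (n : ℝ) ^ 3 * ((S + 2 : ℕ) : ℝ) ≤ 1 / (n : ℝ) ^ 3 * (n : ℝ) := by gcongr
  linarith

/-- An exponential sum with an isolated coefficient, up to one neighbour, is not too small at some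
point close to the origin. -/
lemma exists_large_exponential_sum {d n r m R : ℕ} (hr : 0 < r) (hm : 0 < m) (hR : 2 ≤ R)
    (hRn : R ≤ n) (hsmall : (n : ℝ) ^ d * (n / (R * r)) ^ m ≤ 1 / (2 * n ^ 3))
    (D : (Fin d → Fin n) → ℂ) (hD : ∀ k, ‖D k‖ ≤ 1) (k₀ : Fin d → Fin n) (hk₀ : ‖D k₀‖ = 1)
    (b : Fin d → ℤ)
    (hb : ∀ k, k ≠ k₀ → (fun i => ((k i : ℕ) : ℤ)) ≠ b →
      InCube r (fun i => ((k i : ℕ) : ℤ) - ((k₀ i : ℕ) : ℤ)) → D k = 0) :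
    ∃ t : Fin d → ℕ, (∀ i, t i ≤ m * R) ∧
      1 / (2 * (n : ℝ) ^ 3) ≤ ‖∑ k, D k * ∏ i, phase n (t i) 1 ^ (k i : ℕ)‖ := by
  classical
  have hn0 : (0 : ℝ) < n := by
    have : 0 < n := by lia
    exact_mod_cast this
  have hR0 : (0 : ℝ) < R := by
    have : 0 < R := by lia
    exact_mod_cast this
  have hr0 : (0 : ℝ) < r := by exact_mod_cast hr
  set x : (Fin d → Fin n) → Fin d → ℝ := fun k i => (k i : ℕ) - (k₀ i : ℕ) with hxdef
  have hxn : ∀ k i, |x k i| ≤ n := by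
    intro k i
    have h1 : ((k i : ℕ) : ℝ) < n := by exact_mod_cast (k i).2
    have h2 : ((k₀ i : ℕ) : ℝ) < n := by exact_mod_cast (k₀ i).2
    have h3 : (0 : ℝ) ≤ (k i : ℕ) := Nat.cast_nonneg _
    have h4 : (0 : ℝ) ≤ (k₀ i : ℕ) := Nat.cast_nonneg _
    rw [abs_le]; constructor <;> simp only [x] <;> linarith
  have hxint : ∀ k i, x k i = (((k i : ℕ) : ℤ) - ((k₀ i : ℕ) : ℤ) : ℤ) := by
    intro k i; simp [x]
  let κ : (Fin d → Fin n) → ℂ := fun k => ∏ i, dirichletMean n R (x k i) ^ m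
  have hκ0 : κ k₀ = 1 := by
    have : ∀ i, dirichletMean n R (x k₀ i) = 1 := by
      intro i
      have hR0' : (R : ℂ) ≠ 0 := by exact_mod_cast hR0.ne'
      simp [dirichletMean, x, phase, hR0']
    simp [κ, this]
  have hκle : ∀ k i, ‖κ k‖ ≤ ‖dirichletMean n R (x k i)‖ ^ m := by
    intro k i
    simp only [κ, norm_prod, norm_pow]
    rw [← Finset.mul_prod_erase _ _ (Finset.mem_univ i)]
    refine mul_le_of_le_one_right (by positivity) (Finset.prod_le_one (fun _ _ => by positivity)
      fun j _ => pow_le_one₀ (norm_nonneg _) (norm_dirichletMean_le_one _ _ _))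
  have hκne : ∀ k, k ≠ k₀ → ‖κ k‖ ≤ 1 - 1 / n ^ 3 := by
    intro k hk
    obtain ⟨i, hi⟩ := Function.ne_iff.1 hk
    have h1 : 1 ≤ |x k i| := by
      rw [hxint, ← Int.cast_abs]
      have : ((k i : ℕ) : ℤ) - ((k₀ i : ℕ) : ℤ) ≠ 0 := by
        intro h; apply hi; ext; lia
      exact_mod_cast Int.one_le_abs this
    refine (hκle k i).trans ((pow_le_of_le_one (norm_nonneg _)
      (norm_dirichletMean_le_one _ _ _) hm.ne').trans ?_)
    exact norm_dirichletMean_le_one_sub hR hRn h1 (hxn k i)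
  have hκfar : ∀ k, ¬ InCube r (fun i => ((k i : ℕ) : ℤ) - ((k₀ i : ℕ) : ℤ)) →
      ‖κ k‖ ≤ (n / (R * r)) ^ m := by
    intro k hk
    simp only [InCube, not_forall, not_le] at hk
    obtain ⟨i, hi⟩ := hk
    have h1 : (r : ℝ) ≤ |x k i| := by
      rw [hxint, ← Int.cast_abs]
      exact_mod_cast hi.le
    refine (hκle k i).trans ?_
    gcongr
    refine (norm_dirichletMean_le_div (by lia) (hr0.trans_le h1) (hxn k i)).trans ?_
    gcongr
  -- The term at `k₀` has modulus $1$, the neighbour `b` takes at most $1-1/n^3$, and the far terms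
  -- at most half of the remaining $1/n^3$.
  have hmain : 1 / (2 * (n : ℝ) ^ 3) ≤ ‖∑ k, D k * κ k‖ := by
    have hterm : ∀ k ∈ Finset.univ.erase k₀, ‖D k * κ k‖ ≤ (n / (R * r)) ^ m +
        if (fun i => ((k i : ℕ) : ℤ)) = b then 1 - 1 / (n : ℝ) ^ 3 else 0 := by
      intro k hk
      have hk' := Finset.ne_of_mem_erase hk
      have hle : ‖D k * κ k‖ ≤ ‖κ k‖ := by
        rw [norm_mul]; exact mul_le_of_le_one_left (norm_nonneg _) (hD k)
      split_ifs with h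
      · have := hκne k hk'
        have : (0 : ℝ) ≤ (n / (R * r)) ^ m := by positivity
        linarith
      · rw [add_zero]
        by_cases hc : InCube r (fun i => ((k i : ℕ) : ℤ) - ((k₀ i : ℕ) : ℤ))
        · rw [hb k hk' h hc]
          simp only [zero_mul, norm_zero]
          positivity
        · exact hle.trans (hκfar k hc)
    have hone : ∑ k ∈ Finset.univ.erase k₀,
        (if (fun i => ((k i : ℕ) : ℤ)) = b then 1 - 1 / (n : ℝ) ^ 3 else 0) ≤
          1 - 1 / (n : ℝ) ^ 3 := by
      have hn1 : (0 : ℝ) ≤ 1 - 1 / (n : ℝ) ^ 3 := by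
        have : (1 : ℝ) ≤ n := by exact_mod_cast (by lia : 1 ≤ n)
        rw [sub_nonneg, div_le_one (by positivity)]
        exact one_le_pow₀ this
      rw [← Finset.sum_filter, Finset.sum_const, nsmul_eq_mul]
      refine mul_le_of_le_one_left hn1 ?_
      have : (Finset.filter (fun k : Fin d → Fin n => (fun i => ((k i : ℕ) : ℤ)) = b)
          (Finset.univ.erase k₀)).card ≤ 1 := by
        rw [Finset.card_le_one]
        intro k hk l hl
        have h := (Finset.mem_filter.1 hk).2.trans (Finset.mem_filter.1 hl).2.symm
        funext i
        have := congrFun h i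
        ext; simpa using this
      exact_mod_cast this
    have hrest : ‖∑ k ∈ Finset.univ.erase k₀, D k * κ k‖ ≤
        (n : ℝ) ^ d * (n / (R * r)) ^ m + (1 - 1 / (n : ℝ) ^ 3) := by
      refine (norm_sum_le _ _).trans ((Finset.sum_le_sum hterm).trans ?_)
      rw [Finset.sum_add_distrib]
      refine add_le_add ?_ hone
      rw [Finset.sum_const, nsmul_eq_mul]
      gcongr
      refine (Nat.cast_le.2 (Finset.card_le_univ _)).trans ?_
      simp
    rw [← Finset.add_sum_erase _ _ (Finset.mem_univ k₀), hκ0, mul_one]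
    have h := norm_sub_le_norm_add (D k₀) (∑ k ∈ Finset.univ.erase k₀, D k * κ k)
    have e : 1 / (n : ℝ) ^ 3 = 1 / (2 * (n : ℝ) ^ 3) + 1 / (2 * (n : ℝ) ^ 3) := by
      field_simp; norm_num
    linarith
  -- Expanding the powers of the kernel writes `κ` as an average of characters with frequencies `t ρ
  -- i`, so some character does at least as well as the average.
  let Ω := Fin d × Fin m → Fin R
  let t : Ω → Fin d → ℕ := fun ρ i => ∑ s, (ρ (i, s) : ℕ)
  have hκsum : ∀ k, κ k = (∑ ρ : Ω, ∏ i, phase n (t ρ i) (x k i)) / R ^ (d * m) := by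
    intro k
    have h1 : ∀ ρ : Ω, ∏ i, phase n (t ρ i) (x k i) =
        ∏ p : Fin d × Fin m, phase n (ρ p : ℕ) (x k p.1) := by
      intro ρ
      rw [Fintype.prod_prod_type]
      refine Finset.prod_congr rfl fun i _ => ?_
      simp only [t]
      push_cast
      rw [phase_sum_left]
    simp only [h1]
    have h2 := (Finset.prod_univ_sum (fun _ : Fin d × Fin m => (Finset.univ : Finset (Fin R)))
      (fun p j => phase n (j : ℕ) (x k p.1))).symm
    rw [Fintype.piFinset_univ] at h2
    rw [h2, Fintype.prod_prod_type]
    simp only [Finset.prod_const, Finset.card_univ, Fintype.card_fin, κ, dirichletMean, div_pow]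
    rw [Finset.prod_div_distrib, Finset.prod_const, Finset.card_univ, Fintype.card_fin, ← pow_mul,
      mul_comm m d]
  -- Centring at `k₀` only multiplies the sum by a unimodular constant.
  have hnorm : ∀ ρ : Ω, ‖∑ k, D k * ∏ i, phase n (t ρ i) (x k i)‖ =
      ‖∑ k, D k * ∏ i, phase n (t ρ i) 1 ^ (k i : ℕ)‖ := by
    intro ρ
    have : ∑ k, D k * ∏ i, phase n (t ρ i) 1 ^ (k i : ℕ) =
        (∑ k, D k * ∏ i, phase n (t ρ i) (x k i)) * ∏ i, phase n (t ρ i) (k₀ i : ℕ) := by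
      rw [Finset.sum_mul]
      refine Finset.sum_congr rfl fun k _ => ?_
      rw [mul_assoc, ← Finset.prod_mul_distrib]
      congr 1
      refine Finset.prod_congr rfl fun i _ => ?_
      rw [← phase_add_right, ← phase_natCast_right]
      simp [x]
    rw [this, norm_mul, norm_prod]
    simp [norm_phase]
  by_contra! hcon
  have hall : ∀ ρ : Ω, ‖∑ k, D k * ∏ i, phase n (t ρ i) (x k i)‖ < 1 / (2 * (n : ℝ) ^ 3) := by
    intro ρ
    rw [hnorm]
    refine hcon _ fun i => ?_
    refine (Finset.sum_le_sum (g := fun _ => R) fun s _ => (ρ (i, s)).2.le).trans ?_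
    simp
  have hexch : ∑ k, D k * κ k =
      (∑ ρ : Ω, ∑ k, D k * ∏ i, phase n (t ρ i) (x k i)) / R ^ (d * m) := by
    rw [Finset.sum_comm, Finset.sum_div]
    refine Finset.sum_congr rfl fun k _ => ?_
    rw [hκsum, ← Finset.mul_sum, mul_div_assoc]
  have : Nonempty (Fin R) := ⟨⟨0, by lia⟩⟩
  have hlt : ‖∑ ρ : Ω, ∑ k, D k * ∏ i, phase n (t ρ i) (x k i)‖ <
      R ^ (d * m) * (1 / (2 * (n : ℝ) ^ 3)) := by
    refine (norm_sum_le _ _).trans_lt ((Finset.sum_lt_sum_of_nonempty Finset.univ_nonempty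
      fun ρ _ => hall ρ).trans_eq ?_)
    rw [Finset.sum_const, nsmul_eq_mul, Finset.card_univ]
    simp [Ω]
  rw [hexch, norm_div, norm_pow, Complex.norm_natCast, le_div_iff₀ (by positivity), mul_comm] at hmain
  exact absurd hmain (not_le.2 hlt)

/-! ### Weighted window counts in padded traces and their means. -/

/-- The slices of one direction, padded by `l` slices on either side. -/
abbrev Slot (l m : ℕ) : Type := Fin l ⊕ (Fin m ⊕ Fin l)

/-- Padded slices are numbered from left to right. -/
def slotEquiv (l m : ℕ) : Slot l m ≃ Fin (l + (m + l)) :=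
  (Equiv.sumCongr (Equiv.refl _) finSumFinEquiv).trans finSumFinEquiv

def slotPos {l m : ℕ} (t : Slot l m) : ℕ := slotEquiv l m t

@[simp] lemma slotPos_left {l m : ℕ} (a : Fin l) : slotPos (Sum.inl a : Slot l m) = a := by
  simp [slotPos, slotEquiv]

@[simp] lemma slotPos_mid {l m : ℕ} (b : Fin m) :
    slotPos (Sum.inr (Sum.inl b) : Slot l m) = l + b := by
  simp [slotPos, slotEquiv]

@[simp] lemma slotPos_right {l m : ℕ} (c : Fin l) :
    slotPos (Sum.inr (Sum.inr c) : Slot l m) = l + (m + c) := by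
  simp [slotPos, slotEquiv]

lemma slotPos_injective {l m : ℕ} : Function.Injective (slotPos : Slot l m → ℕ) :=
  Fin.val_injective.comp (slotEquiv l m).injective

/-- An embedding of slices, extended to the padding. -/
def slotMap {l m n : ℕ} (g : Fin m → Fin n) : Slot l m → Slot l n := Sum.map id (Sum.map g id)

lemma slotPos_slotMap_lt {l m n : ℕ} {g : Fin m → Fin n} (hg : StrictMono g) {s t : Slot l m} :
    slotPos (slotMap g s) < slotPos (slotMap g t) ↔ slotPos s < slotPos t := by
  have hlt : ∀ a b : Fin m, (g a : ℕ) < g b ↔ (a : ℕ) < b := fun a b => hg.lt_iff_lt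
  rcases s with a | b | c <;> rcases t with a' | b' | c' <;> simp [slotMap, hlt] <;>
    first
    | done
    | (have := (g b).2; have := b.2; lia)
    | (have := (g b').2; have := b'.2; lia)
    | (have := a.2; lia)
    | (have := a'.2; lia)

/-- The weight of the slot `t` for a choice `f` of slots: `sel` if it is chosen, `z` if it precedes
all chosen slots, `ζ` if it lies between chosen slots, and `1` if it follows all of them. -/
noncomputable def slotWeight {l m s : ℕ} (sel z ζ : ℂ) (f : Fin s → Slot l m) (t : Slot l m) : ℂ :=
  open Classical in
  if ∃ a, f a = t then sel
  else if ∀ a, slotPos t < slotPos (f a) then z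
  else if ∃ a, slotPos t < slotPos (f a) then ζ else 1

lemma slotMap_injective {l m n : ℕ} {g : Fin m → Fin n} (hg : StrictMono g) :
    Function.Injective (slotMap g : Slot l m → Slot l n) :=
  Function.injective_id.sumMap (hg.injective.sumMap Function.injective_id)

/-- Weights depend only on the relative order of slots, which deletion preserves; hence they are
computable without knowing the original positions. -/
lemma slotWeight_slotMap {l m n s : ℕ} {g : Fin m → Fin n} (hg : StrictMono g) (sel z ζ : ℂ)
    (f : Fin s → Slot l m) (t : Slot l m) :
    slotWeight sel z ζ (fun a => slotMap g (f a)) (slotMap g t) = slotWeight sel z ζ f t := by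
  simp only [slotWeight, (slotMap_injective hg).eq_iff, slotPos_slotMap_lt hg]

lemma norm_slotWeight_le {l m s : ℕ} {sel z ζ : ℂ} {ρ : ℝ} (hρ : 1 ≤ ρ) (hsel : ‖sel‖ ≤ ρ)
    (hz : ‖z‖ ≤ ρ) (hζ : ‖ζ‖ ≤ ρ) (f : Fin s → Slot l m) (t : Slot l m) :
    ‖slotWeight sel z ζ f t‖ ≤ ρ := by
  unfold slotWeight
  split_ifs <;> simp_all

/-- Parameters of the weights: the weights `w`, `z` of the slots before the chosen ones (for actual
and for padding slices), the weights `v`, `ζ` of the slots in the gaps, and the survival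
probability `p`. -/
structure WeightParams where
  w : ℂ
  z : ℂ
  v : ℂ
  ζ : ℂ
  p : ℝ

/-- The weight of the choice `f` among the slices of a trace. -/
noncomputable def traceWeight {l m s : ℕ} (P : WeightParams) (f : Fin s → Slot l m) : ℂ :=
  open Classical in
  if StrictMono fun a => slotPos (f a) then
    (∏ a : Fin l, slotWeight P.p P.z P.ζ f (Sum.inl a)) *
      ((∏ b : Fin m, slotWeight 1 P.w P.v f (Sum.inr (Sum.inl b))) *
        ∏ c : Fin l, slotWeight P.p P.z P.ζ f (Sum.inr (Sum.inr c)))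
  else 0

/-- The weight of the choice `f` among the slices of the source, given the deleted slices `δ`. -/
noncomputable def sourceWeight {l n s : ℕ} (P : WeightParams) (δ : Fin n → Bool)
    (f : Fin s → Slot l n) : ℂ :=
  open Classical in
  if StrictMono fun a => slotPos (f a) then
    (∏ a : Fin l, slotWeight P.p P.z P.ζ f (Sum.inl a)) *
      ((∏ b : Fin n, if δ b then (if ∃ a, f a = Sum.inr (Sum.inl b) then 0 else 1)
          else slotWeight 1 P.w P.v f (Sum.inr (Sum.inl b))) *
        ∏ c : Fin l, slotWeight P.p P.z P.ζ f (Sum.inr (Sum.inr c)))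
  else 0

/-- The expected weight of the choice `f` among the slices of the source. -/
noncomputable def meanWeight {l n s : ℕ} (p : ℝ) (z ζ : ℂ) (f : Fin s → Slot l n) : ℂ :=
  open Classical in
  if StrictMono fun a => slotPos (f a) then ∏ t, slotWeight p z ζ f t else 0

/-- Entries of an array padded by zeros. -/
noncomputable def padEntry {d l : ℕ} {m : Fin d → ℕ} (Z : BinArray m)
    (v : (i : Fin d) → Slot l (m i)) : Bool :=
  open Classical in
  if h : ∀ i, ∃ b, v i = Sum.inr (Sum.inl b) then Z fun i => (h i).choose else false

lemma padEntry_mid {d l : ℕ} {m : Fin d → ℕ} (Z : BinArray m) (b : (i : Fin d) → Fin (m i)) :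
    padEntry (l := l) Z (fun i => Sum.inr (Sum.inl (b i))) = Z b := by
  have h : ∀ i, ∃ c, (Sum.inr (Sum.inl (b i)) : Slot l (m i)) = Sum.inr (Sum.inl c) :=
    fun i => ⟨b i, rfl⟩
  rw [padEntry, dif_pos h]
  congr 1
  funext i
  exact (Sum.inl.inj (Sum.inr.inj (h i).choose_spec)).symm

lemma padEntry_of_not {d l : ℕ} {m : Fin d → ℕ} (Z : BinArray m) (v : (i : Fin d) → Slot l (m i))
    (h : ¬ ∀ i, ∃ b, v i = Sum.inr (Sum.inl b)) : padEntry Z v = false := by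
  rw [padEntry, dif_neg h]

/-- A weighted count of the sub-arrays of side `s` of a padded trace, according to their content. -/
noncomputable def windowStat {d s : ℕ} (l : ℕ) (P : Fin d → WeightParams)
    (φ : ((Fin d → Fin s) → Bool) → ℂ) (τ : Trace d) : ℂ :=
  ∑ J : (i : Fin d) → Fin s → Slot l (τ.1 i),
    φ (fun a => padEntry τ.2 fun i => J i (a i)) * ∏ i, traceWeight (P i) (J i)

lemma padEntry_slotMap {d n l : ℕ} {m : Fin d → ℕ} (X : HyperMatrix d n)
    (g : (i : Fin d) → Fin (m i) → Fin n) (v : (i : Fin d) → Slot l (m i)) :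
    padEntry (fun j => X fun i => g i (j i)) v =
      padEntry (m := fun _ => n) X fun i => slotMap (g i) (v i) := by
  by_cases h : ∀ i, ∃ b, v i = Sum.inr (Sum.inl b)
  · choose b hb using h
    obtain rfl : v = fun i => Sum.inr (Sum.inl (b i)) := funext hb
    rw [padEntry_mid]
    exact (padEntry_mid (m := fun _ => n) X _).symm
  · rw [padEntry_of_not _ _ h, padEntry_of_not]
    intro h'
    refine h fun i => ?_
    obtain ⟨b, hb⟩ := h' i
    rcases hv : v i with a | c | a
    · simp [hv, slotMap] at hb
    · exact ⟨c, rfl⟩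
    · simp [hv, slotMap] at hb

lemma traceWeight_eq_sourceWeight {d n l s : ℕ} (P : WeightParams) (ω : DeletionPattern d n)
    (i : Fin d) (f : Fin s → Slot l (survivors ω i).card) :
    traceWeight P f = sourceWeight P (fun b => ω (i, b))
      fun a => slotMap ((survivors ω i).orderEmbOfFin rfl) (f a) := by
  classical
  set g := (survivors ω i).orderEmbOfFin rfl with hg
  have hmono : StrictMono g := g.strictMono
  have hiff : (StrictMono fun a => slotPos (f a)) ↔
      StrictMono fun a => slotPos (slotMap g (f a)) := by
    simp only [StrictMono, slotPos_slotMap_lt hmono]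
  have hrange : ∀ b, b ∈ Set.range g ↔ ω (i, b) = false := by
    intro b
    rw [hg, Finset.range_orderEmbOfFin]
    simp [survivors]
  unfold traceWeight sourceWeight
  rw [if_congr hiff rfl rfl]
  congr 1
  congr 1
  · refine Finset.prod_congr rfl fun a _ => ?_
    exact (slotWeight_slotMap hmono _ _ _ f (Sum.inl a)).symm
  congr 1
  -- A deleted slice contributes the factor $1$, as a choice coming from the trace never selects it.
  · refine Fintype.prod_of_injective g hmono.injective _ _ ?_ ?_
    · intro b hb
      have hb' : ω (i, b) = true := by
        rw [hrange] at hb; simpa using hb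
      rw [if_pos hb', if_neg]
      rintro ⟨a, ha⟩
      rcases hf : f a with c | c | c <;> simp [hf, slotMap] at ha
      exact hb ⟨c, ha⟩
    · intro b
      have hb : ω (i, g b) = false := (hrange _).1 ⟨b, rfl⟩
      rw [if_neg (by simp [hb])]
      exact (slotWeight_slotMap hmono _ _ _ f (Sum.inr (Sum.inl b))).symm
  · refine Finset.prod_congr rfl fun a _ => ?_
    exact (slotWeight_slotMap hmono _ _ _ f (Sum.inr (Sum.inr a))).symm

/-- Reindexing by the source makes the range of summation independent of the deletions: choices that
use a deleted slice have weight zero. -/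
lemma windowStat_traceOf {d n l s : ℕ} (P : Fin d → WeightParams)
    (φ : ((Fin d → Fin s) → Bool) → ℂ) (X : HyperMatrix d n) (ω : DeletionPattern d n) :
    windowStat l P φ (traceOf X ω) = ∑ f : Fin d → Fin s → Slot l n,
      φ (fun a => padEntry (m := fun _ => n) X fun i => f i (a i)) *
        ∏ i, sourceWeight (P i) (fun b => ω (i, b)) (f i) := by
  classical
  refine Fintype.sum_of_injective
    (fun (J : (i : Fin d) → Fin s → Slot l (survivors ω i).card) i a =>
      slotMap ((survivors ω i).orderEmbOfFin rfl) (J i a)) ?_ _ _ ?_ ?_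
  · intro J J' h
    funext i a
    exact slotMap_injective ((survivors ω i).orderEmbOfFin rfl).strictMono
      (congrFun (congrFun h i) a)
  · intro f hf
    by_cases hall : ∀ i a, ∃ t, slotMap ((survivors ω i).orderEmbOfFin rfl) t = f i a
    · choose J hJ using hall
      exact absurd ⟨J, funext fun i => funext fun a => hJ i a⟩ hf
    · push Not at hall
      obtain ⟨i, a, h⟩ := hall
      rw [Finset.prod_eq_zero (Finset.mem_univ i), mul_zero]
      unfold sourceWeight
      split_ifs
      · rcases hfa : f i a with c | b | c
        · exact absurd rfl (hfa ▸ h (Sum.inl c))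
        · have hb : ω (i, b) = true := by
            by_contra hb
            have : b ∈ Set.range ((survivors ω i).orderEmbOfFin rfl) := by
              rw [Finset.range_orderEmbOfFin]; simpa [survivors] using hb
            obtain ⟨c, hc⟩ := this
            refine h (Sum.inr (Sum.inl c)) ?_
            rw [hfa, ← hc]; rfl
          rw [Finset.prod_eq_zero (Finset.mem_univ b)]
          · simp
          · rw [if_pos hb, if_pos ⟨a, hfa⟩]
        · exact absurd rfl (hfa ▸ h (Sum.inr (Sum.inr c)))
      · rfl
  · intro J
    congr 1
    · congr 1
      funext a
      exact padEntry_slotMap X (fun i => (survivors ω i).orderEmbOfFin rfl) _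
    · exact Finset.prod_congr rfl fun i _ => traceWeight_eq_sourceWeight _ ω i _

/-- The padding and gap weights are the expected weights of an actual slice. -/
structure WeightParams.Compatible (P : WeightParams) (q : unitInterval) : Prop where
  z_eq : P.z = q + (1 - q) * P.w
  ζ_eq : P.ζ = q + (1 - q) * P.v
  p_eq : P.p = 1 - q

/-- By independence the mean factors over slices. A chosen slice survives with probability $1-q$,
any other averages its weight with $1$; padding slots, never deleted, carry these means from the
outset. -/
lemma integral_sourceWeight {d n l s : ℕ} (q : unitInterval) (P : Fin d → WeightParams)
    (hP : ∀ i, (P i).Compatible q) (f : Fin d → Fin s → Slot l n) :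
    ∫ ω, ∏ i, sourceWeight (P i) (fun b => ω (i, b)) (f i) ∂deletionLaw q d n =
      ∏ i, meanWeight (P i).p (P i).z (P i).ζ (f i) := by
  classical
  let h : Fin d × Fin n → Bool → ℂ := fun x δ =>
    if δ then (if ∃ a, f x.1 a = Sum.inr (Sum.inl x.2) then 0 else 1)
      else slotWeight 1 (P x.1).w (P x.1).v (f x.1) (Sum.inr (Sum.inl x.2))
  let A : Fin d → ℂ := fun i => if StrictMono fun a => slotPos (f i a) then
    (∏ a : Fin l, slotWeight (P i).p (P i).z (P i).ζ (f i) (Sum.inl a)) *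
      ∏ c : Fin l, slotWeight (P i).p (P i).z (P i).ζ (f i) (Sum.inr (Sum.inr c)) else 0
  have h1 : ∀ ω : DeletionPattern d n, ∏ i, sourceWeight (P i) (fun b => ω (i, b)) (f i) =
      (∏ i, A i) * ∏ x, h x (ω x) := by
    intro ω
    rw [Fintype.prod_prod_type, ← Finset.prod_mul_distrib]
    refine Finset.prod_congr rfl fun i _ => ?_
    simp only [sourceWeight, A, h]
    split_ifs
    · ring
    · ring
  simp only [h1]
  rw [integral_const_mul, deletionLaw, integral_fintype_prod_eq_prod, Fintype.prod_prod_type,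
    ← Finset.prod_mul_distrib]
  refine Finset.prod_congr rfl fun i _ => ?_
  have h2 : ∀ b, ∫ δ, h (i, b) δ ∂bernoulliMeasure true false q =
      slotWeight (P i).p (P i).z (P i).ζ (f i) (Sum.inr (Sum.inl b)) := by
    intro b
    rw [integral_bernoulliMeasure]
    simp only [h, slotWeight, (hP i).z_eq, (hP i).ζ_eq, (hP i).p_eq]
    simp only [Complex.real_smul]
    push_cast
    split_ifs <;> simp_all
  simp only [h2, A, meanWeight, Fintype.prod_sum_type]
  split_ifs
  · ring
  · ring

lemma integral_windowStat {d n l s : ℕ} (q : unitInterval) (P : Fin d → WeightParams)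
    (hP : ∀ i, (P i).Compatible q) (φ : ((Fin d → Fin s) → Bool) → ℂ) (X : HyperMatrix d n) :
    ∫ ω, windowStat l P φ (traceOf X ω) ∂deletionLaw q d n =
      ∑ f : Fin d → Fin s → Slot l n,
        φ (fun a => padEntry (m := fun _ => n) X fun i => f i (a i)) *
          ∏ i, meanWeight (P i).p (P i).z (P i).ζ (f i) := by
  simp only [windowStat_traceOf]
  rw [integral_finsetSum _ fun _ _ => Integrable.of_finite]
  refine Finset.sum_congr rfl fun f _ => ?_
  rw [integral_const_mul, integral_sourceWeight q P hP]

/-- Only the at most $n$ actual slices can have weight above $1$. -/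
lemma norm_sourceWeight_le {l n s : ℕ} {P : WeightParams} {ρ : ℝ} (hρ : 1 ≤ ρ)
    (hw : ‖P.w‖ ≤ ρ) (hz : ‖P.z‖ ≤ 1) (hv : ‖P.v‖ ≤ 1) (hζ : ‖P.ζ‖ ≤ 1) (hp : |P.p| ≤ 1)
    (δ : Fin n → Bool) (f : Fin s → Slot l n) : ‖sourceWeight P δ f‖ ≤ ρ ^ n := by
  classical
  have hpad : ∀ t, ‖slotWeight P.p P.z P.ζ f t‖ ≤ 1 :=
    norm_slotWeight_le le_rfl (by simpa using hp) hz hζ f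
  unfold sourceWeight
  split_ifs
  · rw [norm_mul, norm_mul, norm_prod, norm_prod, norm_prod]
    refine (mul_le_of_le_one_left (by positivity) (Finset.prod_le_one (fun _ _ => norm_nonneg _)
      fun _ _ => hpad _)).trans ?_
    refine (mul_le_of_le_one_right (by positivity) (Finset.prod_le_one (fun _ _ => norm_nonneg _)
      fun _ _ => hpad _)).trans ?_
    refine (Finset.prod_le_prod (g := fun _ => ρ) (fun _ _ => norm_nonneg _) fun b _ => ?_).trans ?_
    · split_ifs
      · simp; linarith
      · simpa using hρ
      · exact norm_slotWeight_le hρ (by simpa using hρ) hw (hv.trans hρ) f _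
    · simp
  · rw [norm_zero]; positivity

lemma norm_windowStat_le {d n l s : ℕ} {P : Fin d → WeightParams} {ρ : ℝ} (hρ : 1 ≤ ρ)
    (hw : ∀ i, ‖(P i).w‖ ≤ ρ) (hz : ∀ i, ‖(P i).z‖ ≤ 1) (hv : ∀ i, ‖(P i).v‖ ≤ 1)
    (hζ : ∀ i, ‖(P i).ζ‖ ≤ 1) (hp : ∀ i, |(P i).p| ≤ 1) {φ : ((Fin d → Fin s) → Bool) → ℂ}
    (hφ : ∀ u, ‖φ u‖ ≤ 1) (X : HyperMatrix d n) (ω : DeletionPattern d n) :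
    ‖windowStat l P φ (traceOf X ω)‖ ≤ ((n + 2 * l : ℕ) : ℝ) ^ (s * d) * ρ ^ (n * d) := by
  rw [windowStat_traceOf]
  refine (norm_sum_le _ _).trans ((Finset.sum_le_sum (g := fun _ => ρ ^ (n * d))
    fun f _ => ?_).trans ?_)
  · rw [norm_mul, norm_prod]
    refine (mul_le_of_le_one_left (by positivity) (hφ _)).trans ?_
    refine (Finset.prod_le_prod (g := fun _ => ρ ^ n) (fun _ _ => norm_nonneg _) fun i _ =>
      norm_sourceWeight_le hρ (hw i) (hz i) (hv i) (hζ i) (hp i) _ _).trans ?_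
    simp [pow_mul]
  · simp only [Finset.sum_const, Finset.card_univ, Fintype.card_fun, Fintype.card_sum,
      Fintype.card_fin, nsmul_eq_mul]
    have : l + (n + l) = n + 2 * l := by ring
    rw [this, ← pow_mul]
    push_cast
    exact le_rfl

/-! ### Gap weight zero: contiguous windows only. -/

/-- The zero extension of a hypermatrix. -/
def zeroExt {d n : ℕ} (X : HyperMatrix d n) (k : Fin d → ℤ) : Bool :=
  if h : ∀ i, 0 ≤ k i ∧ k i < n then X fun i => ⟨(k i).toNat, by have := h i; lia⟩ else false

lemma padEntry_eq_zeroExt {d n l : ℕ} (X : HyperMatrix d n) (v : Fin d → Slot l n) :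
    padEntry (m := fun _ => n) X v = zeroExt X fun i => (slotPos (v i) : ℤ) - l := by
  by_cases h : ∀ i, ∃ b, v i = Sum.inr (Sum.inl b)
  · choose b hb using h
    obtain rfl : v = fun i => Sum.inr (Sum.inl (b i)) := funext hb
    rw [padEntry_mid (m := fun _ => n), zeroExt, dif_pos]
    · congr 1
      funext i
      ext
      simp
    · intro i
      have := (b i).2
      simp
  · rw [padEntry_of_not _ _ h, zeroExt, dif_neg]
    intro h'
    refine h fun i => ?_
    have h2 := h' i
    rcases hv : v i with a | c | a
    · simp [hv] at h2
      have := a.2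
      lia
    · exact ⟨c, rfl⟩
    · simp [hv] at h2
      lia

/-- The choice of `2 * l + 1` consecutive slots starting at position `k`. -/
def slotRun {l n : ℕ} (k : Fin n) (a : Fin (2 * l + 1)) : Slot l n :=
  (slotEquiv l n).symm ⟨k + a, by have := k.2; have := a.2; lia⟩

@[simp] lemma slotPos_slotRun {l n : ℕ} (k : Fin n) (a : Fin (2 * l + 1)) :
    slotPos (slotRun k a : Slot l n) = k + a := by
  simp [slotPos, slotRun]

lemma slotRun_injective {l n : ℕ} :
    Function.Injective (slotRun : Fin n → Fin (2 * l + 1) → Slot l n) := by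
  intro k k' h
  have := congrArg slotPos (congrFun h 0)
  ext
  simpa using this

/-- A run has no gaps: `k` slots precede it, `2 * l + 1` are chosen, and the rest have weight $1$.
Its middle slot, at position `k + l`, is the actual slice `k`. -/
lemma meanWeight_slotRun {l n : ℕ} (p : ℝ) (z : ℂ) (k : Fin n) :
    meanWeight p z 0 (slotRun k : Fin (2 * l + 1) → Slot l n) =
      (p : ℂ) ^ (2 * l + 1) * z ^ (k : ℕ) := by
  classical
  have hmono : StrictMono fun a => slotPos (slotRun k a : Slot l n) := by
    intro a b hab
    have : (a : ℕ) < b := hab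
    simpa using this
  rw [meanWeight, if_pos hmono]
  let h : ℕ → ℂ := fun t => if t < k then z else if t < k + (2 * l + 1) then (p : ℂ) else 1
  have h1 : ∀ t : Slot l n,
      slotWeight p z 0 (slotRun k : Fin (2 * l + 1) → Slot l n) t = h (slotPos t) := by
    intro t
    have e1 : (∃ a, slotRun k a = t) ↔ (k : ℕ) ≤ slotPos t ∧ slotPos t < k + (2 * l + 1) := by
      constructor
      · rintro ⟨a, rfl⟩
        have := a.2
        simp only [slotPos_slotRun]
        lia
      · rintro ⟨h1, h2⟩
        refine ⟨⟨slotPos t - k, by lia⟩, slotPos_injective ?_⟩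
        simp only [slotPos_slotRun]
        lia
    have e2 : (∀ a : Fin (2 * l + 1), slotPos t < slotPos (slotRun k a : Slot l n)) ↔
        slotPos t < k := by
      constructor
      · intro h
        simpa using h 0
      · intro h a
        simp only [slotPos_slotRun]
        lia
    have e3 : (∃ a : Fin (2 * l + 1), slotPos t < slotPos (slotRun k a : Slot l n)) ↔
        slotPos t < k + 2 * l := by
      constructor
      · rintro ⟨a, ha⟩
        have := a.2
        simp only [slotPos_slotRun] at ha
        lia
      · intro h
        exact ⟨⟨2 * l, by lia⟩, by simpa using h⟩
    simp only [slotWeight, e1, e2, e3, h]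
    split_ifs <;> first | rfl | lia
  simp only [h1]
  have h2 : ∏ t : Slot l n, h (slotPos t) = ∏ t : Fin (l + (n + l)), h t :=
    (slotEquiv l n).prod_comp fun t : Fin (l + (n + l)) => h t
  rw [h2, Fin.prod_univ_eq_prod_range]
  have hN : l + (n + l) = k + ((2 * l + 1) + (n - 1 - k)) := by have := k.2; lia
  rw [hN, Finset.prod_range_add, Finset.prod_range_add]
  have g1 : ∏ t ∈ Finset.range k, h t = z ^ (k : ℕ) := by
    rw [Finset.prod_congr rfl fun t ht => if_pos (Finset.mem_range.1 ht)]
    simp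
  have g2 : ∏ t ∈ Finset.range (2 * l + 1), h (k + t) = (p : ℂ) ^ (2 * l + 1) := by
    rw [Finset.prod_congr rfl fun t ht => (if_neg (by lia)).trans
      (if_pos (by have := Finset.mem_range.1 ht; lia))]
    simp
  have g3 : ∏ t ∈ Finset.range (n - 1 - k), h (k + (2 * l + 1 + t)) = 1 :=
    Finset.prod_eq_one fun t _ => (if_neg (by lia)).trans (if_neg (by lia))
  rw [g1, g2, g3]
  ring

lemma meanWeight_eq_zero {l n : ℕ} (p : ℝ) (z : ℂ) (f : Fin (2 * l + 1) → Slot l n)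
    (hf : ∀ k, slotRun k ≠ f) : meanWeight p z 0 f = 0 := by
  classical
  by_contra hne
  rw [meanWeight] at hne
  split_ifs at hne with hmono
  · have hstep : ∀ a (ha : a + 1 < 2 * l + 1),
        slotPos (f ⟨a + 1, ha⟩) = slotPos (f ⟨a, by lia⟩) + 1 := by
      intro a ha
      by_contra hcon
      have hlt : slotPos (f ⟨a, by lia⟩) < slotPos (f ⟨a + 1, ha⟩) :=
        hmono (by simp [Fin.lt_def])
      have hN : slotPos (f ⟨a + 1, ha⟩) < l + (n + l) := (slotEquiv l n _).2
      -- If two consecutive chosen slots are not adjacent, the slot right after the first is a gap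
      -- and contributes the factor $0$.
      let t : Slot l n := (slotEquiv l n).symm ⟨slotPos (f ⟨a, by lia⟩) + 1, by lia⟩
      have ht : slotPos t = slotPos (f ⟨a, by lia⟩) + 1 := by simp [t, slotPos]
      refine hne (Finset.prod_eq_zero (Finset.mem_univ t) ?_)
      rw [slotWeight, if_neg, if_neg, if_pos]
      · exact ⟨⟨a + 1, ha⟩, by lia⟩
      · intro h
        have := h ⟨a, by lia⟩
        lia
      · rintro ⟨b, hb⟩
        rw [← hb] at ht
        have h1 : (⟨a, by lia⟩ : Fin (2 * l + 1)) < b := by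
          rw [← hmono.lt_iff_lt]; lia
        have h2 : b < ⟨a + 1, ha⟩ := by
          rw [← hmono.lt_iff_lt]; lia
        simp only [Fin.lt_def] at h1 h2
        lia
    have hall : ∀ a (ha : a < 2 * l + 1), slotPos (f ⟨a, ha⟩) = slotPos (f 0) + a := by
      intro a
      induction a with
      | zero => intro _; rfl
      | succ a ih => intro ha; rw [hstep a ha, ih (by lia)]; lia
    have hlast := hall (2 * l) (by lia)
    have hN : slotPos (f ⟨2 * l, by lia⟩) < l + (n + l) := (slotEquiv l n _).2
    refine hf ⟨slotPos (f 0), by lia⟩ (funext fun a => slotPos_injective ?_)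
    rw [slotPos_slotRun, hall a a.2]
  · exact hne rfl

/-- With weight zero for the gaps only consecutive slots contribute. -/
lemma sum_meanWeight_zero {d l n : ℕ} (p : ℝ) (z : Fin d → ℂ)
    (Ψ : (Fin d → Fin (2 * l + 1) → Slot l n) → ℂ) :
    ∑ f, Ψ f * ∏ i, meanWeight p (z i) 0 (f i) =
      (p : ℂ) ^ ((2 * l + 1) * d) *
        ∑ k : Fin d → Fin n, Ψ (fun i => slotRun (k i)) * ∏ i, z i ^ (k i : ℕ) := by
  rw [Finset.mul_sum]
  symm
  refine Fintype.sum_of_injective (fun (k : Fin d → Fin n) i => slotRun (k i)) ?_ _ _ ?_ ?_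
  · intro k k' h
    funext i
    exact slotRun_injective (congrFun h i)
  · intro f hf
    have : ∃ i, ∀ k, slotRun k ≠ f i := by
      by_contra! hcon
      choose k hk using hcon
      exact hf ⟨k, funext hk⟩
    obtain ⟨i, hi⟩ := this
    rw [Finset.prod_eq_zero (Finset.mem_univ i) (meanWeight_eq_zero _ _ _ hi), mul_zero]
  · intro k
    simp only [meanWeight_slotRun, Finset.prod_mul_distrib, Finset.prod_const, Finset.card_univ,
      Fintype.card_fin, ← pow_mul]
    ring

/-! ### Moving the gap weight by the maximum principle; size of the weights. -/

/-- Every point of a circle can be rotated by a multiple of `2 π / h` to a point at most `2 π / h`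
away from the positive real axis. -/
lemma exists_rotation_near {h : ℕ} (hh : 0 < h) {ρ : ℝ} {ζ : ℂ} (hζ : ‖ζ‖ = ρ) :
    ∃ j : Fin h, ‖ζ * Complex.exp (((2 * Real.pi * (j : ℕ) / h : ℝ) : ℂ) * Complex.I) - ρ‖ ≤
      ρ * (2 * Real.pi / h) := by
  have hpi := Real.pi_pos
  have hh' : (0 : ℝ) < h := by exact_mod_cast hh
  -- The argument is taken in $(0,2\pi]$ so that the rounded-down number of rotations needed to
  -- complete a full turn is below `h`.
  obtain ⟨α, hα0, hα1, hα⟩ : ∃ α : ℝ, 0 < α ∧ α ≤ 2 * Real.pi ∧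
      ζ = ρ * Complex.exp (α * Complex.I) := by
    have h1 := Complex.norm_mul_exp_arg_mul_I ζ
    rw [hζ] at h1
    rcases lt_or_ge 0 ζ.arg with h0 | h0
    · exact ⟨ζ.arg, h0, by linarith [Complex.arg_le_pi ζ], h1.symm⟩
    · refine ⟨ζ.arg + 2 * Real.pi, by linarith [Complex.neg_pi_lt_arg ζ], by linarith, ?_⟩
      push_cast
      rw [add_mul, Complex.exp_add, Complex.exp_two_pi_mul_I, mul_one]
      exact h1.symm
  have hx0 : 0 ≤ (2 * Real.pi - α) * h / (2 * Real.pi) := by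
    have : 0 ≤ 2 * Real.pi - α := by linarith
    positivity
  have hx1 : (2 * Real.pi - α) * h / (2 * Real.pi) < h := by
    rw [div_lt_iff₀ (by positivity)]
    nlinarith
  refine ⟨⟨⌊(2 * Real.pi - α) * h / (2 * Real.pi)⌋₊, (Nat.floor_lt hx0).2 hx1⟩, ?_⟩
  set j := ⌊(2 * Real.pi - α) * h / (2 * Real.pi)⌋₊
  have hj1 : (j : ℝ) ≤ (2 * Real.pi - α) * h / (2 * Real.pi) := Nat.floor_le hx0
  have hj2 : (2 * Real.pi - α) * h / (2 * Real.pi) < j + 1 := Nat.lt_floor_add_one _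
  rw [le_div_iff₀ (by positivity)] at hj1
  rw [div_lt_iff₀ (by positivity)] at hj2
  set β : ℝ := α + 2 * Real.pi * j / h - 2 * Real.pi with hβ
  have hexp : ζ * Complex.exp (((2 * Real.pi * j / h : ℝ) : ℂ) * Complex.I) - ρ =
      ρ * (Complex.exp (Complex.I * β) - 1) := by
    have e : Complex.I * (β : ℂ) = α * Complex.I +
        ((2 * Real.pi * j / h : ℝ) : ℂ) * Complex.I - 2 * Real.pi * Complex.I := by
      rw [hβ]; push_cast; ring
    rw [e, Complex.exp_sub, Complex.exp_add, Complex.exp_two_pi_mul_I, hα]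
    ring
  have hβle : |β| ≤ 2 * Real.pi / h := by
    have e : β = -(((2 * Real.pi - α) * h - j * (2 * Real.pi)) / h) := by
      rw [hβ]; field_simp; ring
    rw [e, abs_neg, abs_of_nonneg (div_nonneg (by linarith) hh'.le)]
    gcongr
    linarith
  have hρ : 0 ≤ ρ := hζ ▸ norm_nonneg ζ
  simp only
  rw [hexp, norm_mul, Complex.norm_real, Real.norm_eq_abs, abs_of_nonneg hρ]
  gcongr
  exact (Real.norm_exp_I_mul_ofReal_sub_one_le).trans hβle

/-- A bounded holomorphic function that is not small at the origin is not small somewhere on a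
given circle around the origin close to the positive real axis. -/
lemma exists_large_near_positive_real {F : ℂ → ℂ} (hF : Differentiable ℂ F) {B ε ρ : ℝ} {h : ℕ}
    (hh : 0 < h) (hε : 0 ≤ ε) (hρ0 : 0 < ρ) (hρ1 : ρ ≤ 1) (hB : ∀ ζ, ‖ζ‖ ≤ 1 → ‖F ζ‖ ≤ B)
    (hF0 : ε ≤ ‖F 0‖) :
    ∃ ζ : ℂ, ‖ζ‖ = ρ ∧ ‖ζ - ρ‖ ≤ ρ * (2 * Real.pi / h) ∧ ε ^ h ≤ ‖F ζ‖ * B ^ (h - 1) := by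
  classical
  let e : Fin h → ℂ := fun j => Complex.exp (((2 * Real.pi * (j : ℕ) / h : ℝ) : ℂ) * Complex.I)
  have he : ∀ j, ‖e j‖ = 1 := fun j => Complex.norm_exp_ofReal_mul_I _
  -- $H(0)=F(0)^h$, and wherever $H$ is large on the circle, one factor is evaluated near the
  -- positive real axis while the others are at most $B$.
  let H : ℂ → ℂ := fun ζ => ∏ j, F (ζ * e j)
  have hH : Differentiable ℂ H := by
    refine Differentiable.fun_finsetProd fun j _ => ?_
    exact hF.comp (differentiable_id.mul_const _)
  obtain ⟨ζ, hζ, hmax⟩ := Complex.exists_mem_frontier_isMaxOn_norm (f := H)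
    (U := Metric.ball (0 : ℂ) ρ) Metric.isBounded_ball ⟨0, Metric.mem_ball_self hρ0⟩
    hH.diffContOnCl
  rw [frontier_ball _ hρ0.ne', mem_sphere_zero_iff_norm] at hζ
  have h0 : ‖H 0‖ ≤ ‖H ζ‖ := hmax (subset_closure (Metric.mem_ball_self hρ0))
  obtain ⟨j, hj⟩ := exists_rotation_near hh hζ
  refine ⟨ζ * e j, by rw [norm_mul, he, hζ, mul_one], hj, ?_⟩
  have h1 : ε ^ h ≤ ‖H 0‖ := by
    simp only [H, zero_mul, Finset.prod_const, Finset.card_univ, Fintype.card_fin, norm_pow]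
    gcongr
  refine h1.trans (h0.trans ?_)
  simp only [H, norm_prod]
  rw [← Finset.mul_prod_erase _ _ (Finset.mem_univ j)]
  gcongr
  refine (Finset.prod_le_prod (g := fun _ => B) (fun _ _ => norm_nonneg _) fun i _ =>
    hB _ ?_).trans ?_
  · rw [norm_mul, he, hζ, mul_one]; exact hρ1
  · simp

lemma differentiable_meanWeight {l n s : ℕ} (p : ℝ) (z : ℂ) (f : Fin s → Slot l n) :
    Differentiable ℂ fun ζ => meanWeight p z ζ f := by
  classical
  unfold meanWeight
  split_ifs
  · refine Differentiable.fun_finsetProd fun t _ => ?_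
    unfold slotWeight
    split_ifs <;> fun_prop
  · fun_prop

lemma norm_meanWeight_le {l n s : ℕ} {p : ℝ} {z ζ : ℂ} (hp : |p| ≤ 1) (hz : ‖z‖ ≤ 1)
    (hζ : ‖ζ‖ ≤ 1) (f : Fin s → Slot l n) : ‖meanWeight p z ζ f‖ ≤ 1 := by
  classical
  unfold meanWeight
  split_ifs
  · rw [norm_prod]
    exact Finset.prod_le_one (fun _ _ => norm_nonneg _) fun t _ =>
      norm_slotWeight_le le_rfl (by simpa using hp) hz hζ f t
  · simp

/-- The weight `w` with `q + (1 - q) w = e ^ {i θ}` exceeds the unit circle only to second order. -/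
lemma norm_exp_sub_div_le {q θ : ℝ} (hq0 : 0 ≤ q) (hq1 : q < 1) :
    ‖(Complex.exp (θ * Complex.I) - q) / (1 - q)‖ ≤ Real.exp (θ ^ 2 / (1 - q) ^ 2) := by
  have hp : 0 < 1 - q := by linarith
  have h1 : ‖Complex.exp (θ * Complex.I) - q‖ ^ 2 = (1 - q) ^ 2 + 2 * q * (1 - Real.cos θ) := by
    rw [Complex.sq_norm, Complex.normSq_apply]
    simp only [Complex.sub_re, Complex.sub_im, Complex.exp_ofReal_mul_I_re,
      Complex.exp_ofReal_mul_I_im, Complex.ofReal_re, Complex.ofReal_im, sub_zero]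
    nlinarith [Real.sin_sq_add_cos_sq θ]
  have h2 : 1 - Real.cos θ ≤ θ ^ 2 / 2 := by linarith [Real.one_sub_sq_div_two_le_cos (x := θ)]
  have h3 : ‖(Complex.exp (θ * Complex.I) - q) / (1 - q)‖ ^ 2 ≤
      Real.exp (θ ^ 2 / (1 - q) ^ 2) := by
    have e : ‖(1 - q : ℂ)‖ = 1 - q := by
      rw [← Complex.ofReal_one, ← Complex.ofReal_sub, Complex.norm_real, Real.norm_eq_abs,
        abs_of_pos hp]
    rw [norm_div, e, div_pow, h1]
    refine le_trans ?_ (Real.add_one_le_exp _)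
    rw [div_add_one (by positivity), div_le_div_iff_of_pos_right (by positivity)]
    nlinarith [sq_nonneg θ]
  -- A square root is given away here: from $a^2\le E$ and $E\ge1$ follows $a\le E$.
  have h4 : 1 ≤ Real.exp (θ ^ 2 / (1 - q) ^ 2) := Real.one_le_exp (by positivity)
  exact abs_le_of_sq_le_sq' (h3.trans (by nlinarith)) (by linarith) |>.2

/-! ### Assembling the separating statistic. -/

lemma zeroExt_natCast {d n : ℕ} (X : HyperMatrix d n) (k : Fin d → Fin n) :
    zeroExt X (fun i => ((k i : ℕ) : ℤ)) = X k := by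
  rw [zeroExt, dif_pos]
  · congr 1
  · intro i
    have := (k i).2
    lia

lemma exists_fin_of_zeroExt_ne {d n : ℕ} {X Y : HyperMatrix d n} {k : Fin d → ℤ}
    (h : zeroExt X k ≠ zeroExt Y k) : ∃ k' : Fin d → Fin n, k = fun i => ((k' i : ℕ) : ℤ) := by
  by_cases hk : ∀ i, 0 ≤ k i ∧ k i < n
  · refine ⟨fun i => ⟨(k i).toNat, by have := hk i; lia⟩, funext fun i => ?_⟩
    have := hk i
    simp only
    lia
  · rw [zeroExt, zeroExt, dif_neg hk, dif_neg hk] at h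
    exact absurd rfl h

/-- Two distinct hypermatrices are separated by an indicator of a window pattern: some exponential
sum close to the origin over the differences of its occurrences is not small. -/
lemma exists_window_function {d n r m R : ℕ} (hr : 0 < r) (hm : 0 < m) (hR : 2 ≤ R)
    (hRn : R ≤ n) (hsmall : (n : ℝ) ^ d * (n / (R * r)) ^ m ≤ 1 / (2 * n ^ 3))
    {X Y : HyperMatrix d n} (hXY : X ≠ Y) :
    ∃ φ : ((Fin d → Fin (2 * (4 * r) + 1)) → Bool) → ℂ, (∀ u v, ‖φ u - φ v‖ ≤ 1) ∧
      (∀ u, ‖φ u‖ ≤ 1) ∧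
      ∃ t : Fin d → ℕ, (∀ i, t i ≤ m * R) ∧
        1 / (2 * (n : ℝ) ^ 3) ≤ ‖∑ k : Fin d → Fin n,
          (φ (fun a => padEntry (l := 4 * r) (m := fun _ => n) X fun i => slotRun (k i) (a i)) -
            φ (fun a => padEntry (l := 4 * r) (m := fun _ => n) Y fun i => slotRun (k i) (a i))) *
              ∏ i, phase n (t i) 1 ^ (k i : ℕ)‖ := by
  classical
  have hne : zeroExt X ≠ zeroExt Y := by
    intro h
    refine hXY (funext fun k => ?_)
    rw [← zeroExt_natCast X, ← zeroExt_natCast Y, h]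
  have hfin : {k | zeroExt X k ≠ zeroExt Y k}.Finite := by
    refine (Set.finite_range fun (k : Fin d → Fin n) (i : Fin d) => ((k i : ℕ) : ℤ)).subset ?_
    intro k hk
    obtain ⟨k', rfl⟩ := exists_fin_of_zeroExt_ne hk
    exact ⟨k', rfl⟩
  obtain ⟨φ, hloc, h01, k₀, hk₀, hD, b, hb⟩ :=
    exists_separating_pattern r (zeroExt X) (zeroExt Y) hfin hne
  obtain ⟨k₀, rfl⟩ := exists_fin_of_zeroExt_ne hk₀
  -- Recentres a finite window at the origin. The default outside is immaterial, because `φ` only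
  -- looks at the cube of radius $4r$.
  let ψ : ((Fin d → Fin (2 * (4 * r) + 1)) → Bool) → (Fin d → ℤ) → Bool := fun u j =>
    if h : ∀ i, 0 ≤ j i + (4 * r : ℕ) ∧ j i + (4 * r : ℕ) < (2 * (4 * r) + 1 : ℕ) then
      u fun i => ⟨(j i + (4 * r : ℕ)).toNat, by have := h i; lia⟩ else false
  have hwin : ∀ (Z : HyperMatrix d n) (k : Fin d → Fin n),
      φ (ψ fun a => padEntry (l := 4 * r) (m := fun _ => n) Z fun i => slotRun (k i) (a i)) =
        φ fun j => zeroExt Z ((fun i => ((k i : ℕ) : ℤ)) + j) := by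
    intro Z k
    refine hloc _ _ fun j hj => ?_
    have hj' : ∀ i, 0 ≤ j i + (4 * r : ℕ) ∧ j i + (4 * r : ℕ) < (2 * (4 * r) + 1 : ℕ) := by
      intro i
      have := abs_le.1 (hj i)
      constructor <;> push_cast at * <;> linarith
    simp only [ψ]
    rw [dif_pos hj', padEntry_eq_zeroExt]
    congr 1
    funext i
    have := hj' i
    simp only [slotPos_slotRun, Pi.add_apply]
    lia
  have hdiff : ∀ u v, ‖((φ u : ℤ) : ℂ) - ((φ v : ℤ) : ℂ)‖ ≤ 1 := by
    intro u v
    have h1 := h01 u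
    have h2 := h01 v
    rw [← Int.cast_sub, Complex.norm_intCast]
    have : |φ u - φ v| ≤ 1 := abs_le.2 ⟨by lia, by lia⟩
    exact_mod_cast this
  refine ⟨fun u => ((φ (ψ u) : ℤ) : ℂ), fun u v => hdiff _ _, fun u => ?_, ?_⟩
  · have h1 := h01 (ψ u)
    rw [Complex.norm_intCast]
    have : |φ (ψ u)| ≤ 1 := abs_le.2 ⟨by lia, by lia⟩
    exact_mod_cast this
  · simp only [hwin]
    refine exists_large_exponential_sum hr hm hR hRn hsmall
      (fun k => ((φ fun j => zeroExt X ((fun i => ((k i : ℕ) : ℤ)) + j) : ℤ) : ℂ) -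
        ((φ fun j => zeroExt Y ((fun i => ((k i : ℕ) : ℤ)) + j) : ℤ) : ℂ))
      (fun k => hdiff _ _) k₀ ?_ b ?_
    · rw [← Int.cast_sub, Complex.norm_intCast]
      exact_mod_cast hD
    · intro k hk hkb hnear
      rw [sub_eq_zero]
      congr 1
      refine hb _ (fun h => hk ?_) hkb hnear
      funext i
      have := congrFun h i
      ext
      simpa using this

/-- A bounded complex statistic whose means differ has a real or imaginary part with this
property. -/
lemma exists_real_statistic {d n : ℕ} (q : unitInterval) (S : Trace d → ℂ) {B δ : ℝ} (hB : 0 < B)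
    (hS : ∀ (Z : HyperMatrix d n) ω, ‖S (traceOf Z ω)‖ ≤ B) (X Y : HyperMatrix d n)
    (hδ : δ ≤ ‖∫ ω, S (traceOf X ω) ∂deletionLaw q d n -
      ∫ ω, S (traceOf Y ω) ∂deletionLaw q d n‖) :
    ∃ G : Trace d → ℝ, (∀ (Z : HyperMatrix d n) ω, |G (traceOf Z ω)| ≤ 1) ∧
      δ / (2 * B) ≤ |meanStat q G X - meanStat q G Y| := by
  have hre : ∀ Z : HyperMatrix d n, meanStat q (fun τ => (S τ).re / B) Z =
      (∫ ω, S (traceOf Z ω) ∂deletionLaw q d n).re / B := by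
    intro Z
    rw [meanStat, integral_div]
    congr 1
    exact integral_re (𝕜 := ℂ) Integrable.of_finite
  have him : ∀ Z : HyperMatrix d n, meanStat q (fun τ => (S τ).im / B) Z =
      (∫ ω, S (traceOf Z ω) ∂deletionLaw q d n).im / B := by
    intro Z
    rw [meanStat, integral_div]
    congr 1
    exact integral_im (𝕜 := ℂ) Integrable.of_finite
  set x := ∫ ω, S (traceOf X ω) ∂deletionLaw q d n
  set y := ∫ ω, S (traceOf Y ω) ∂deletionLaw q d n
  have hsum := hδ.trans (Complex.norm_le_abs_re_add_abs_im (x - y))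
  rw [Complex.sub_re, Complex.sub_im] at hsum
  rcases le_or_gt (δ / 2) |x.re - y.re| with h | h
  · refine ⟨fun τ => (S τ).re / B, fun Z ω => ?_, ?_⟩
    · rw [abs_div, abs_of_pos hB, div_le_one hB]
      exact (Complex.abs_re_le_norm _).trans (hS Z ω)
    · rw [hre, hre, ← sub_div, abs_div, abs_of_pos hB, ← div_div]
      gcongr
  · refine ⟨fun τ => (S τ).im / B, fun Z ω => ?_, ?_⟩
    · rw [abs_div, abs_of_pos hB, div_le_one hB]
      exact (Complex.abs_im_le_norm _).trans (hS Z ω)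
    · rw [him, him, ← sub_div, abs_div, abs_of_pos hB, ← div_div]
      gcongr
      linarith

/-- Any two distinct hypermatrices are separated by a bounded statistic of a trace. -/
lemma exists_separating_statistic {d n r m R h : ℕ} (q : unitInterval) (hq0 : 0 < q) (hq1 : q < 1)
    (hr : 0 < r) (hm : 0 < m) (hR : 2 ≤ R) (hRn : R ≤ n) (hh : 0 < h)
    (hhq : 2 * Real.pi / h ≤ 1 - q)
    (hsmall : (n : ℝ) ^ d * (n / (R * r)) ^ m ≤ 1 / (2 * n ^ 3))
    {X Y : HyperMatrix d n} (hXY : X ≠ Y) :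
    ∃ G : Trace d → ℝ, (∀ (Z : HyperMatrix d n) ω, |G (traceOf Z ω)| ≤ 1) ∧
      (((1 - q : ℝ) ^ ((8 * r + 1) * d) * (1 / (2 * (n : ℝ) ^ 3))) ^ h /
        (((n + 8 * r : ℕ) : ℝ) ^ ((8 * r + 1) * d)) ^ (h - 1)) /
      (2 * (((n + 8 * r : ℕ) : ℝ) ^ ((8 * r + 1) * d) *
        Real.exp ((Real.pi * (m * R) / n) ^ 2 / (1 - q) ^ 2) ^ (n * d))) ≤
        |meanStat q G X - meanStat q G Y| := by
  classical
  have hq0' : (0 : ℝ) < q := hq0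
  have hq1' : (q : ℝ) < 1 := hq1
  have hp : (0 : ℝ) < 1 - q := by linarith
  have hpabs : |(1 - q : ℝ)| ≤ 1 := by rw [abs_of_pos hp]; linarith
  have hn : 0 < n := by lia
  have hn' : (0 : ℝ) < n := by exact_mod_cast hn
  have hr8 : 2 * (4 * r) + 1 = 8 * r + 1 := by ring
  have hN : n + 2 * (4 * r) = n + 8 * r := by ring
  obtain ⟨φ, hφ2, hφ1, t, ht, hlarge⟩ := exists_window_function hr hm hR hRn hsmall hXY
  set z : Fin d → ℂ := fun i => phase n (t i) 1 with hz
  have hz1 : ∀ i, ‖z i‖ ≤ 1 := fun i => (norm_phase _ _ _).le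
  let val : HyperMatrix d n → (Fin d → Fin (2 * (4 * r) + 1) → Slot (4 * r) n) → ℂ := fun Z f =>
    φ fun a => padEntry (l := 4 * r) (m := fun _ => n) Z fun i => f i (a i)
  let F : ℂ → ℂ := fun ζ => ∑ f, (val X f - val Y f) * ∏ i, meanWeight (1 - q : ℝ) (z i) ζ (f i)
  set M : ℝ := ((n + 8 * r : ℕ) : ℝ) ^ ((8 * r + 1) * d) with hM
  have hMpos : 0 < M := by positivity
  have hFd : Differentiable ℂ F := by
    refine Differentiable.fun_sum fun f _ => (differentiable_const _).mul ?_
    exact Differentiable.fun_finsetProd fun i _ => differentiable_meanWeight _ _ _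
  have hFB : ∀ ζ, ‖ζ‖ ≤ 1 → ‖F ζ‖ ≤ M := by
    intro ζ hζ
    refine (norm_sum_le _ _).trans ((Finset.sum_le_sum (g := fun _ => (1 : ℝ)) fun f _ => ?_).trans
      ?_)
    · rw [norm_mul, norm_prod]
      exact mul_le_one₀ (hφ2 _ _) (by positivity) (Finset.prod_le_one (fun _ _ => norm_nonneg _)
        fun i _ => norm_meanWeight_le hpabs (hz1 i) hζ _)
    · simp only [Finset.sum_const, Finset.card_univ, Fintype.card_fun, Fintype.card_sum,
        Fintype.card_fin, nsmul_eq_mul, mul_one]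
      have : 4 * r + (n + 4 * r) = n + 8 * r := by ring
      rw [this, ← pow_mul, hr8, hM]
      push_cast
      exact le_rfl
  have hF0 : (1 - q : ℝ) ^ ((8 * r + 1) * d) * (1 / (2 * (n : ℝ) ^ 3)) ≤ ‖F 0‖ := by
    simp only [F]
    rw [sum_meanWeight_zero, norm_mul, norm_pow, Complex.norm_real, Real.norm_eq_abs,
      abs_of_pos hp, hr8]
    gcongr
  obtain ⟨ζ, hζq, hζ, hFζ⟩ := exists_large_near_positive_real hFd (h := h) hh (by positivity) hq0'
    hq1'.le hFB hF0
  have hζ1 : ‖ζ‖ ≤ 1 := hζq.le.trans hq1'.le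
  -- This is what the choice of `h` is for: it makes the gap weight $v=(\zeta-q)/(1-q)$ at most $1$
  -- in modulus.
  have hζp : ‖ζ - q‖ ≤ 1 - q :=
    hζ.trans ((mul_le_of_le_one_left (by positivity) hq1'.le).trans hhq)
  have hpC : (1 - q : ℂ) ≠ 0 := by
    rw [← Complex.ofReal_one, ← Complex.ofReal_sub]
    exact_mod_cast hp.ne'
  have hpn : ‖(1 - q : ℂ)‖ = 1 - q := by
    rw [← Complex.ofReal_one, ← Complex.ofReal_sub, Complex.norm_real, Real.norm_eq_abs,
      abs_of_pos hp]
  let P : Fin d → WeightParams := fun i =>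
    { w := (z i - q) / (1 - q), z := z i, v := (ζ - q) / (1 - q), ζ := ζ, p := 1 - q }
  have hP : ∀ i, (P i).Compatible q := by
    intro i
    refine ⟨?_, ?_, rfl⟩
    · simp only [P]; field_simp; ring
    · simp only [P]; field_simp; ring
  set ρ : ℝ := Real.exp ((Real.pi * (m * R) / n) ^ 2 / (1 - q) ^ 2) with hρ
  have hρ1 : 1 ≤ ρ := Real.one_le_exp (by positivity)
  have hw : ∀ i, ‖(P i).w‖ ≤ ρ := by
    intro i
    refine (norm_exp_sub_div_le hq0'.le hq1').trans ?_
    rw [hρ, Real.exp_le_exp]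
    have hpi := Real.pi_pos
    have : (t i : ℝ) ≤ m * R := by exact_mod_cast ht i
    rw [mul_one]
    gcongr
  have hv : ∀ i, ‖(P i).v‖ ≤ 1 := by
    intro i
    simp only [P]
    rw [norm_div, hpn, div_le_one hp]
    exact hζp
  have hbound := fun (Z : HyperMatrix d n) ω => norm_windowStat_le (l := 4 * r) (P := P) hρ1 hw hz1
    hv (fun _ => hζ1) (fun _ => hpabs) hφ1 Z ω
  have hMeq : ((n + 2 * (4 * r) : ℕ) : ℝ) ^ ((2 * (4 * r) + 1) * d) = M := by rw [hN, hr8]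
  rw [hMeq] at hbound
  refine exists_real_statistic q (windowStat (4 * r) P φ) (by positivity) hbound X Y ?_
  rw [integral_windowStat q P hP, integral_windowStat q P hP, ← Finset.sum_sub_distrib]
  simp only [← sub_mul]
  rw [div_le_iff₀ (by positivity)]
  exact hFζ

/-! ### Choice of parameters and conclusion. -/

lemma natCeil_le_two_mul {x : ℝ} (hx : 1 ≤ x) : (⌈x⌉₊ : ℝ) ≤ 2 * x := by
  linarith [Nat.ceil_lt_add_one (zero_le_one.trans hx)]

/-- The separation of two distinct hypermatrices by the mean of a bounded statistic. -/
lemma exists_separation (q : unitInterval) (hq0 : 0 < q) (hq1 : q < 1) (d : ℕ) :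
    ∃ C : ℝ, 0 < C ∧ ∀ᶠ n : ℕ in atTop, ∀ X Y : HyperMatrix d n, X ≠ Y → ∃ G : Trace d → ℝ,
      (∀ (Z : HyperMatrix d n) ω, |G (traceOf Z ω)| ≤ 1) ∧
        Real.exp (-(C * (n : ℝ) ^ (3 / 7 : ℝ))) ≤ |meanStat q G X - meanStat q G Y| := by
  have hq1' : (q : ℝ) < 1 := hq1
  have hp : (0 : ℝ) < 1 - q := by linarith
  have hpi := Real.pi_pos
  obtain ⟨h, hh⟩ : ∃ h : ℕ, 2 * Real.pi / (1 - q) < h := exists_nat_gt _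
  have hh0' : (0 : ℝ) < h := lt_trans (by positivity) hh
  have hh0 : 0 < h := by exact_mod_cast hh0'
  have hhq : 2 * Real.pi / h ≤ 1 - q := by
    rw [div_lt_iff₀ hp] at hh
    rw [div_le_iff₀ hh0']
    linarith
  -- Below, $n/(Rr)\le n^{-4/35}$, so this power is at most $n^{-4(d+4)}$ and beats the $n^d$ terms
  -- of the sum.
  set m : ℕ := 35 * (d + 4) with hm
  set lam : ℝ := -Real.log (1 - q) with hlam
  have hlam0 : 0 ≤ lam := by
    have hq0' : (0 : ℝ) < q := hq0
    rw [hlam, neg_nonneg]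
    exact Real.log_nonpos hp.le (by linarith)
  -- With $u=n^{3/7}$: $8r+1\le17n^{2/5}$ and $\log n\le35n^{1/35}$ give $17d\lambda u$ for the
  -- survival of the window, $140u$ for $2n^3\le n^4$, and $1190du$ for the number of choices, each
  -- `h` times. The $1$ absorbs a factor $2\le e^u$, and the last term is the excess of the weights
  -- over the unit circle.
  refine ⟨h * (17 * d * lam + 140 + 1190 * d) + 1 + 4 * d * Real.pi ^ 2 * m ^ 2 / (1 - q) ^ 2,
    by positivity, ?_⟩
  -- The first bound gives $n+8r\le17n\le n^2$, the second gives $R\ge2$.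
  filter_upwards [eventually_ge_atTop 17, eventually_ge_atTop (2 ^ 8)] with n hn17 hn8 X Y hXY
  have hn1 : (1 : ℝ) ≤ n := by exact_mod_cast (by lia : 1 ≤ n)
  have hn0 : (0 : ℝ) < n := by linarith
  have hn17' : (17 : ℝ) ≤ n := by exact_mod_cast hn17
  set r : ℕ := ⌈(n : ℝ) ^ (2 / 5 : ℝ)⌉₊ with hr
  set R : ℕ := ⌈(n : ℝ) ^ (5 / 7 : ℝ)⌉₊ with hR
  set u : ℝ := (n : ℝ) ^ (3 / 7 : ℝ) with hu
  have h25 : (1 : ℝ) ≤ (n : ℝ) ^ (2 / 5 : ℝ) := Real.one_le_rpow hn1 (by norm_num)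
  have h57 : (2 : ℝ) ≤ (n : ℝ) ^ (5 / 7 : ℝ) := by
    calc (2 : ℝ) = ((2 : ℝ) ^ (8 : ℕ)) ^ (1 / 8 : ℝ) := by
          rw [← Real.rpow_natCast, ← Real.rpow_mul (by norm_num)]; norm_num
      _ ≤ (n : ℝ) ^ (1 / 8 : ℝ) := by
          gcongr
          exact_mod_cast hn8
      _ ≤ (n : ℝ) ^ (5 / 7 : ℝ) := Real.rpow_le_rpow_of_exponent_le hn1 (by norm_num)
  have hu1 : 1 ≤ u := Real.one_le_rpow hn1 (by norm_num)
  have hr1 : 0 < r := Nat.ceil_pos.2 (by linarith)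
  have hr_le : (r : ℝ) ≤ 2 * (n : ℝ) ^ (2 / 5 : ℝ) := natCeil_le_two_mul h25
  have hr_ge : (n : ℝ) ^ (2 / 5 : ℝ) ≤ r := Nat.le_ceil _
  have hR_le : (R : ℝ) ≤ 2 * (n : ℝ) ^ (5 / 7 : ℝ) := natCeil_le_two_mul (by linarith)
  have hR_ge : (n : ℝ) ^ (5 / 7 : ℝ) ≤ R := Nat.le_ceil _
  have hR2 : 2 ≤ R := by exact_mod_cast h57.trans hR_ge
  have hRn : R ≤ n := by
    refine Nat.ceil_le.2 ?_
    calc (n : ℝ) ^ (5 / 7 : ℝ) ≤ (n : ℝ) ^ (1 : ℝ) :=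
          Real.rpow_le_rpow_of_exponent_le hn1 (by norm_num)
      _ = n := Real.rpow_one _
  have hsmall : (n : ℝ) ^ d * (n / (R * r)) ^ m ≤ 1 / (2 * n ^ 3) := by
    have h1 : (n : ℝ) / (R * r) ≤ (n : ℝ) ^ (-(4 / 35) : ℝ) := by
      calc (n : ℝ) / (R * r) ≤ n / ((n : ℝ) ^ (5 / 7 : ℝ) * (n : ℝ) ^ (2 / 5 : ℝ)) := by gcongr
        _ = (n : ℝ) ^ (1 : ℝ) / (n : ℝ) ^ (39 / 35 : ℝ) := by
          rw [← Real.rpow_add hn0, Real.rpow_one]; norm_num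
        _ = (n : ℝ) ^ (-(4 / 35) : ℝ) := by rw [← Real.rpow_sub hn0]; norm_num
    have h2 : ((n : ℝ) ^ (-(4 / 35) : ℝ)) ^ m = 1 / (n : ℝ) ^ (4 * (d + 4)) := by
      rw [← Real.rpow_natCast, ← Real.rpow_mul hn0.le, hm, one_div, ← Real.rpow_natCast,
        ← Real.rpow_neg hn0.le]
      congr 1
      push_cast
      ring
    calc (n : ℝ) ^ d * (n / (R * r)) ^ m ≤ (n : ℝ) ^ d * ((n : ℝ) ^ (-(4 / 35) : ℝ)) ^ m := by
          gcongr
      _ = (n : ℝ) ^ d / (n : ℝ) ^ (4 * (d + 4)) := by rw [h2]; ring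
      _ ≤ 1 / (2 * n ^ 3) := by
          rw [div_le_div_iff₀ (by positivity) (by positivity), one_mul]
          calc (n : ℝ) ^ d * (2 * n ^ 3) ≤ (n : ℝ) ^ d * (n * n ^ 3) := by
                gcongr; linarith
            _ = (n : ℝ) ^ (d + 4) := by ring
            _ ≤ (n : ℝ) ^ (4 * (d + 4)) := pow_le_pow_right₀ hn1 (by lia)
  obtain ⟨G, hG, hsep⟩ := exists_separating_statistic (m := m) q hq0 hq1 hr1 (by lia) hR2 hRn hh0
    hhq hsmall hXY
  refine ⟨G, hG, le_trans ?_ hsep⟩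
  set S : ℕ := (8 * r + 1) * d with hS
  have hlog0 : 0 ≤ Real.log n := Real.log_nonneg hn1
  have hlog : Real.log n ≤ 35 * (n : ℝ) ^ (1 / 35 : ℝ) := by
    have := Real.log_le_rpow_div hn0.le (ε := 1 / 35) (by norm_num)
    linarith
  have hS_le : (S : ℝ) ≤ 17 * d * (n : ℝ) ^ (2 / 5 : ℝ) := by
    rw [hS]; push_cast
    have : (8 * r + 1 : ℝ) ≤ 17 * (n : ℝ) ^ (2 / 5 : ℝ) := by linarith
    calc (8 * r + 1 : ℝ) * d ≤ 17 * (n : ℝ) ^ (2 / 5 : ℝ) * d := by gcongr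
      _ = _ := by ring
  have hSu : (S : ℝ) ≤ 17 * d * u := by
    refine hS_le.trans ?_
    gcongr
    exact Real.rpow_le_rpow_of_exponent_le hn1 (by norm_num)
  -- The exponents match exactly: $2/5+1/35=3/7$.
  have hSlog : S * Real.log n ≤ 595 * d * u := by
    calc S * Real.log n ≤ (17 * d * (n : ℝ) ^ (2 / 5 : ℝ)) * (35 * (n : ℝ) ^ (1 / 35 : ℝ)) := by
          gcongr
      _ = 595 * d * ((n : ℝ) ^ (2 / 5 : ℝ) * (n : ℝ) ^ (1 / 35 : ℝ)) := by ring
      _ = 595 * d * u := by rw [← Real.rpow_add hn0]; norm_num [hu]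
  have hlogu : Real.log n ≤ 35 * u := by
    refine hlog.trans ?_
    gcongr
    exact Real.rpow_le_rpow_of_exponent_le hn1 (by norm_num)
  have hM : ((n + 8 * r : ℕ) : ℝ) ^ S ≤ Real.exp (1190 * d * u) := by
    have h25n : (n : ℝ) ^ (2 / 5 : ℝ) ≤ n := by
      calc (n : ℝ) ^ (2 / 5 : ℝ) ≤ (n : ℝ) ^ (1 : ℝ) :=
            Real.rpow_le_rpow_of_exponent_le hn1 (by norm_num)
        _ = n := Real.rpow_one _
    have h1 : ((n + 8 * r : ℕ) : ℝ) ≤ Real.exp (2 * Real.log n) := by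
      rw [two_mul, Real.exp_add, Real.exp_log hn0]
      push_cast
      calc (n : ℝ) + 8 * r ≤ 17 * n := by linarith
        _ ≤ n * n := by gcongr
    calc ((n + 8 * r : ℕ) : ℝ) ^ S ≤ Real.exp (2 * Real.log n) ^ S := by gcongr
      _ = Real.exp (2 * (S * Real.log n)) := by rw [← Real.exp_nat_mul]; ring_nf
      _ ≤ _ := by rw [Real.exp_le_exp]; linarith
  have hpS : Real.exp (-(17 * d * lam * u)) ≤ (1 - q : ℝ) ^ S := by
    rw [← Real.exp_log hp, ← Real.exp_nat_mul, Real.exp_le_exp]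
    have := mul_le_mul_of_nonneg_right hSu hlam0
    simp only [hlam] at this ⊢
    linarith
  have hn3 : Real.exp (-(140 * u)) ≤ 1 / (2 * (n : ℝ) ^ 3) := by
    rw [Real.exp_neg, ← one_div]
    refine one_div_le_one_div_of_le (by positivity) ?_
    calc 2 * (n : ℝ) ^ 3 ≤ n * n ^ 3 := by gcongr; linarith
      _ = Real.exp (4 * Real.log n) := by
        rw [show (4 : ℝ) = (4 : ℕ) by norm_num, Real.exp_nat_mul, Real.exp_log hn0]; ring
      _ ≤ Real.exp (140 * u) := by rw [Real.exp_le_exp]; linarith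
  have hρ : Real.exp ((Real.pi * (m * R) / n) ^ 2 / (1 - q) ^ 2) ^ (n * d) ≤
      Real.exp (4 * d * Real.pi ^ 2 * m ^ 2 / (1 - q) ^ 2 * u) := by
    rw [← Real.exp_nat_mul, Real.exp_le_exp]
    have hRR : (R : ℝ) ^ 2 / n ≤ 4 * u := by
      calc (R : ℝ) ^ 2 / n ≤ (2 * (n : ℝ) ^ (5 / 7 : ℝ)) ^ 2 / n := by gcongr
        _ = 4 * (((n : ℝ) ^ (5 / 7 : ℝ)) ^ (2 : ℕ) / (n : ℝ) ^ (1 : ℝ)) := by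
          rw [Real.rpow_one]; ring
        _ = 4 * u := by
          rw [← Real.rpow_natCast, ← Real.rpow_mul hn0.le, ← Real.rpow_sub hn0]
          norm_num [hu]
    calc ((n * d : ℕ) : ℝ) * ((Real.pi * (m * R) / n) ^ 2 / (1 - q) ^ 2)
        = d * Real.pi ^ 2 * m ^ 2 / (1 - q) ^ 2 * ((R : ℝ) ^ 2 / n) := by
          push_cast; field_simp
      _ ≤ d * Real.pi ^ 2 * m ^ 2 / (1 - q) ^ 2 * (4 * u) := by gcongr
      _ = _ := by ring
  set M : ℝ := ((n + 8 * r : ℕ) : ℝ) ^ S with hMdef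
  have hMpos : 0 < M := by positivity
  have h2u : (2 : ℝ) ≤ Real.exp u := by linarith [Real.add_one_le_exp u]
  obtain ⟨g, rfl⟩ := Nat.exists_eq_succ_of_ne_zero hh0.ne'
  rw [Nat.succ_sub_one, div_div]
  rw [le_div_iff₀ (by positivity)]
  calc Real.exp (-(((g.succ : ℕ) * (17 * d * lam + 140 + 1190 * d) + 1 +
          4 * d * Real.pi ^ 2 * m ^ 2 / (1 - q) ^ 2) * u)) *
        (M ^ g * (2 * (M * Real.exp ((Real.pi * (m * R) / n) ^ 2 / (1 - q) ^ 2) ^ (n * d))))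
      ≤ Real.exp (-(((g.succ : ℕ) * (17 * d * lam + 140 + 1190 * d) + 1 +
          4 * d * Real.pi ^ 2 * m ^ 2 / (1 - q) ^ 2) * u)) *
        (Real.exp (1190 * d * u) ^ g * (Real.exp u * (Real.exp (1190 * d * u) *
          Real.exp (4 * d * Real.pi ^ 2 * m ^ 2 / (1 - q) ^ 2 * u)))) := by gcongr
    _ = (Real.exp (-(17 * d * lam * u)) * Real.exp (-(140 * u))) ^ g.succ := by
        simp only [← Real.exp_nat_mul, ← Real.exp_add]
        congr 1
        push_cast
        ring
    _ ≤ ((1 - q : ℝ) ^ S * (1 / (2 * (n : ℝ) ^ 3))) ^ g.succ := by gcongr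

lemma eventually_pow_le_exp_rpow (d : ℕ) :
    ∀ᶠ n : ℕ in atTop, 8 * (2 * (n : ℝ) ^ d + n) ≤ Real.exp ((n : ℝ) ^ (3 / 7 : ℝ)) := by
  -- A multiple of $7$, so that the `k`-th power of $n^{3/7}$ is an integer power of $n$.
  set k := 7 * (d + 2) with hk
  filter_upwards [eventually_ge_atTop 1, eventually_ge_atTop (24 * k.factorial)] with n hn1 hnk
  have hn1' : (1 : ℝ) ≤ n := by exact_mod_cast hn1
  have hnk' : (24 * k.factorial : ℝ) ≤ n := by exact_mod_cast hnk
  have hn0 : (0 : ℝ) < n := by linarith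
  refine le_trans ?_ (Real.pow_div_factorial_le_exp _ (by positivity) k)
  have h1 : ((n : ℝ) ^ (3 / 7 : ℝ)) ^ k = (n : ℝ) ^ (3 * (d + 2)) := by
    rw [← Real.rpow_natCast, ← Real.rpow_mul hn0.le, ← Real.rpow_natCast]
    congr 1
    rw [hk]
    push_cast
    ring
  rw [h1, le_div_iff₀ (by positivity)]
  have h2 : (n : ℝ) ^ d ≤ (n : ℝ) ^ (d + 1) := pow_le_pow_right₀ hn1' (by lia)
  have h3 : (n : ℝ) ≤ (n : ℝ) ^ (d + 1) := le_self_pow₀ hn1' (by lia)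
  calc 8 * (2 * (n : ℝ) ^ d + n) * k.factorial
      ≤ 8 * (2 * (n : ℝ) ^ (d + 1) + (n : ℝ) ^ (d + 1)) * k.factorial := by gcongr
    _ = (n : ℝ) ^ (d + 1) * (24 * k.factorial) := by ring
    _ ≤ (n : ℝ) ^ (d + 1) * n := by gcongr
    _ = (n : ℝ) ^ (d + 2) := by ring
    _ ≤ (n : ℝ) ^ (3 * (d + 2)) := pow_le_pow_right₀ hn1' (by lia)

/-- In every dimension `exp (O (n ^ (3 / 7)))` traces suffice. -/
theorem tracesSuffice_exp (q : unitInterval) (hq0 : 0 < q) (hq1 : q < 1) (d : ℕ) :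
    ∃ C : ℝ, 0 < C ∧ ∀ g : ℕ → ℝ, (∀ᶠ n : ℕ in atTop, (n : ℝ) ^ (3 / 7 : ℝ) ≤ g n) →
      TracesSuffice q d fun n => ⌈Real.exp (C * g n)⌉₊ := by
  obtain ⟨C, hC, hsep⟩ := exists_separation q hq0 hq1 d
  -- $2C$ compensates the squared separation, and $1$ the polynomial number of traces per squared
  -- separation.
  refine ⟨2 * C + 1, by positivity, fun g hg => ?_⟩
  refine tracesSuffice_of_separating q d _ (fun n => Real.exp (-(C * (n : ℝ) ^ (3 / 7 : ℝ))))
    (fun n => Real.exp_pos _) hsep ?_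
  filter_upwards [hg, eventually_pow_le_exp_rpow d] with n hgn hn
  refine hn.trans ?_
  calc Real.exp ((n : ℝ) ^ (3 / 7 : ℝ))
      = Real.exp (-(C * (n : ℝ) ^ (3 / 7 : ℝ))) ^ 2 *
          Real.exp ((2 * C + 1) * (n : ℝ) ^ (3 / 7 : ℝ)) := by
        rw [← Real.exp_nat_mul, ← Real.exp_add]
        congr 1
        push_cast
        ring
    _ ≤ Real.exp (-(C * (n : ℝ) ^ (3 / 7 : ℝ))) ^ 2 * (⌈Real.exp ((2 * C + 1) * g n)⌉₊ : ℝ) := by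
        gcongr
        refine le_trans ?_ (Nat.le_ceil _)
        gcongr

lemma eventually_rpow_le_rpow_mul_log {a b : ℝ} (ha : (3 / 7 : ℝ) ≤ a) (hb : 0 ≤ b) :
    ∀ᶠ n : ℕ in atTop, (n : ℝ) ^ (3 / 7 : ℝ) ≤ (n : ℝ) ^ a * Real.log n ^ b := by
  filter_upwards [eventually_ge_atTop 3] with n hn
  have hn3 : (3 : ℝ) ≤ n := by exact_mod_cast hn
  have hlog : 1 ≤ Real.log n := by
    rw [Real.le_log_iff_exp_le (by linarith)]
    linarith [Real.exp_one_lt_d9]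
  calc (n : ℝ) ^ (3 / 7 : ℝ) ≤ (n : ℝ) ^ a :=
        Real.rpow_le_rpow_of_exponent_le (by linarith) ha
    _ ≤ (n : ℝ) ^ a * Real.log n ^ b :=
        le_mul_of_one_le_right (by positivity) (Real.one_le_rpow hlog hb)

theorem theorem1 (q : unitInterval) (hq0 : 0 < q) (hq1 : q < 1) :
    (∃ C : ℝ, 0 < C ∧ TracesSuffice q 2 fun n =>
      ⌈Real.exp (C * ((n : ℝ) ^ (3 / 7 : ℝ) * Real.log n ^ (10 / 3 : ℝ)))⌉₊) ∧
    (∃ C : ℝ, 0 < C ∧ TracesSuffice q 3 fun n =>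
      ⌈Real.exp (C * ((n : ℝ) ^ (5 / 9 : ℝ) * Real.log n ^ (5 / 2 : ℝ)))⌉₊) ∧
    (∀ d : ℕ, 4 ≤ d → ∃ C : ℝ, 0 < C ∧ TracesSuffice q d fun n =>
      ⌈Real.exp (C * ((n : ℝ) ^ (3 / 5 : ℝ) * Real.log n))⌉₊) := by
  refine ⟨?_, ?_, fun d _ => ?_⟩
  · obtain ⟨C, hC, h⟩ := tracesSuffice_exp q hq0 hq1 2
    exact ⟨C, hC, h _ (eventually_rpow_le_rpow_mul_log le_rfl (by norm_num))⟩
  · obtain ⟨C, hC, h⟩ := tracesSuffice_exp q hq0 hq1 3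
    exact ⟨C, hC, h _ (eventually_rpow_le_rpow_mul_log (by norm_num) (by norm_num))⟩
  · obtain ⟨C, hC, h⟩ := tracesSuffice_exp q hq0 hq1 d
    have h35 := eventually_rpow_le_rpow_mul_log (a := 3 / 5) (b := 1) (by norm_num) zero_le_one
    simp only [Real.rpow_one] at h35
    exact ⟨C, hC, h _ h35⟩
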